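/- Consider stochastic multi-armed bandits with $n\ge 2$ arms whose reward distributions $\nu_1,\dots,\nu_n$ belong to a class $\mathcal D$ of probability distributions on $[0,1]$ that contains all Bernoulli distributions. An algorithm for Best Arm Identification (BAI) chooses in each round $t$ an arm $a_t$, possibly at random, depending on the past rounds, and receives a reward $r_t\sim\nu_{a_t}$; it stops at a stopping time $T$ with respect to the filtration $\mathcal F_t=\sigma(a_1,r_1,\dots,a_t,r_t)$ and then outputs an arm, possibly at random, depending on the rounds played. With $\mu_i$ the mean of $\nu_i$, arm $i$ is $\varepsilon$-optimal if $\max_j\mu_j-\mu_i<\varepsilon$. The algorithm is $(\varepsilon,\delta)$-PAC if on every instance it stops and outputs an $\varepsilon$-optimal arm with probability at least $1-\delta$. The sample complexity of $(\varepsilon,\delta)$-PAC BAI with $n$ arms is the infimum, over all $(\varepsilon,\delta)$-PAC algorithms, of the supremum of $\mathbb E_\nu[T]$ over all instances $\nu$. For every $\beta\in(0,1)$ there are constants $c,C>0$, depending only on $\beta$, such that for all such $\mathcal D$, all $n\ge 2$, all $0<\varepsilon\le\frac18$ and all $0<\delta\le\frac{n-1}{n}(1-\beta)$, the sample complexity lies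 between $$c\,\frac{n-1}{\varepsilon^2}\log\frac{n-1}{n\delta}\qquad\text{and}\qquad C\,\frac{n-1}{\varepsilon^2}\log\frac{n-1}{n\delta}.$$ That is, it is $\Theta\!\left(\frac{n-1}{\varepsilon^2}\log\frac{n-1}{n\delta}\right)$; in particular this covers values $\delta\ge\frac12$ when $n\ge3$ and $\beta$ is small enough. -/

import Mathlib

open MeasureTheory ProbabilityTheory
open scoped ENNReal

noncomputable section

namespace Bandit

/-- One round of play: the arm that is pulled, together with the reward that is received. -/
abbrev Step (n : ℕ) : Type := Fin n × ℝ

/-- The first `t` rounds of an infinite sequence of rounds. -/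
def hist {n : ℕ} (t : ℕ) (ω : ℕ → Step n) : Fin t → Step n := fun i => ω i

lemma measurable_hist {n : ℕ} (t : ℕ) : Measurable (hist (n := n) t) :=
  measurable_pi_lambda _ fun i => measurable_pi_apply (i : ℕ)

/-- The filtration `𝓕 t = σ(a₁, r₁, …, a_t, r_t)`; in particular `𝓕 0` is trivial. -/
def historyFiltration (n : ℕ) :
    Filtration ℕ (inferInstance : MeasurableSpace (ℕ → Step n)) where
  seq t := MeasurableSpace.comap (hist t) inferInstance
  mono' := by
    intro s t hst
    have h : hist (n := n) s = (fun (x : Fin t → Step n) (i : Fin s) => x (Fin.castLE hst i)) ∘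
        hist t := rfl
    change MeasurableSpace.comap (hist s) _ ≤ _
    rw [h, ← MeasurableSpace.comap_comp]
    refine MeasurableSpace.comap_mono (Measurable.comap_le ?_)
    exact measurable_pi_lambda _ fun i => measurable_pi_apply _
  le' t := (measurable_hist t).comap_le

/-- A stochastic multi-armed bandit instance: one reward distribution for each of the `n` arms. -/
abbrev Instance (n : ℕ) : Type := Fin n → ProbabilityMeasure ℝ

/-- The mean reward `μ_i` of arm `i`. -/
def Instance.mean {n : ℕ} (ν : Instance n) (i : Fin n) : ℝ := ∫ x, x ∂(ν i : Measure ℝ)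

/-- Arm `i` is `ε`-optimal if its gap to the best mean is (strictly) less than `ε`. -/
def Instance.IsOptimal {n : ℕ} (ν : Instance n) (ε : ℝ) (i : Fin n) : Prop :=
  (⨆ j, ν.mean j) - ν.mean i < ε

/-- The reward of a pull of arm `i` is drawn from `ν i`. -/
def Instance.rewardKernel {n : ℕ} (ν : Instance n) : Kernel (Fin n) ℝ :=
  Kernel.ofFunOfCountable fun i => (ν i : Measure ℝ)

instance Instance.isMarkovKernel_rewardKernel {n : ℕ} (ν : Instance n) :
    IsMarkovKernel ν.rewardKernel :=
  ⟨fun i => by change IsProbabilityMeasure (ν i : Measure ℝ); infer_instance⟩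

/-- A (randomized, adaptive) algorithm for best arm identification with `n` arms. It does not see
the instance, only the history of pulled arms and received rewards. -/
structure Algorithm (n : ℕ) where
  /-- The distribution of the arm pulled next, given the first `t` rounds. -/
  policy : (t : ℕ) → Kernel (Fin t → Step n) (Fin n)
  markov_policy : ∀ t, IsMarkovKernel (policy t)
  /-- The number of samples `T`, possibly infinite. -/
  time : (ℕ → Step n) → WithTop ℕ
  isStoppingTime_time : IsStoppingTime (historyFiltration n) time
  /-- The distribution of the output arm, given that the algorithm has stopped after `t` rounds. -/
  output : (t : ℕ) → Kernel (Fin t → Step n) (Fin n)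
  markov_output : ∀ t, IsMarkovKernel (output t)

attribute [instance] Algorithm.markov_policy Algorithm.markov_output

namespace Algorithm

variable {n : ℕ} (A : Algorithm n) (ν : Instance n)

/-- The first round: pull an arm according to the policy and draw a reward from that arm. -/
def firstStep : Measure (Step n) := A.policy 0 Fin.elim0 ⊗ₘ ν.rewardKernel

/-- The round that follows rounds number `0, …, t`: given these, pull an arm according to the
policy and draw a reward from that arm, independently of everything else. -/
def nextStep (t : ℕ) : Kernel (Finset.Iic t → Step n) (Step n) :=
  (A.policy (t + 1)).comap
      (fun (h : Finset.Iic t → Step n) (i : Fin (t + 1)) =>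
        h ⟨(i : ℕ), Finset.mem_Iic.2 (Nat.lt_succ_iff.1 i.2)⟩)
      (measurable_pi_lambda _ fun _ => measurable_pi_apply _) ⊗ₖ
    Kernel.prodMkLeft _ ν.rewardKernel

instance isMarkovKernel_nextStep (t : ℕ) : IsMarkovKernel (A.nextStep ν t) := by
  unfold nextStep; infer_instance

/-- The law of the sequence of rounds when the algorithm plays on the instance `ν`. -/
def law : Measure (ℕ → Step n) :=
  Kernel.trajMeasure (X := fun _ => Step n) (A.firstStep ν) (A.nextStep ν)

/-- The expected number of samples `E_ν[T]`. -/
def expectedTime : ℝ≥0∞ := ∫⁻ ω, ENat.toENNReal (A.time ω) ∂(A.law ν)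

/-- The probability that, on the instance `ν`, the algorithm stops and outputs an arm in `S`. -/
def outputProb (S : Set (Fin n)) : ℝ≥0∞ :=
  ∑' t : ℕ, ∫⁻ ω in {ω | A.time ω = t}, A.output t (hist t ω) S ∂(A.law ν)

/-- `(ε, δ)`-PAC for best arm identification, where the reward distributions of the arms may be
any members of the class `𝒟`: on every instance the algorithm outputs an `ε`-optimal arm with
probability at least `1 - δ`. -/
def IsPAC (𝒟 : Set (ProbabilityMeasure ℝ)) (ε δ : ℝ) : Prop :=
  ∀ ν : Instance n, (∀ i, ν i ∈ 𝒟) → ENNReal.ofReal (1 - δ) ≤ A.outputProb ν {i | ν.IsOptimal ε i}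

/-- The worst-case expected number of samples over the instances with arms from `𝒟`. -/
def worstCaseTime (𝒟 : Set (ProbabilityMeasure ℝ)) : ℝ≥0∞ :=
  ⨆ (ν : Instance n) (_ : ∀ i, ν i ∈ 𝒟), A.expectedTime ν

end Algorithm

/-- The sample complexity of `(ε, δ)`-PAC best arm identification with `n` arms: the least
worst-case expected number of samples among all `(ε, δ)`-PAC algorithms. -/
def sampleComplexity (𝒟 : Set (ProbabilityMeasure ℝ)) (n : ℕ) (ε δ : ℝ) : ℝ≥0∞ :=
  ⨅ (A : Algorithm n) (_ : A.IsPAC 𝒟 ε δ), A.worstCaseTime 𝒟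

/-- The Bernoulli reward distributions (rewards `1` and `0`). -/
def bernoulliRewards : Set (ProbabilityMeasure ℝ) :=
  {ρ | ∃ p : unitInterval, (ρ : Measure ℝ) = bernoulliMeasure 1 0 p}

/-- The reward distributions that are supported on `[0, 1]`. -/
def unitRewards : Set (ProbabilityMeasure ℝ) :=
  {ρ | ∀ᵐ x ∂(ρ : Measure ℝ), x ∈ Set.Icc (0 : ℝ) 1}

end Bandit

end

/-!
Both bounds compare with `log ((n - 1) / (n δ))`, which under the assumption on `δ` is at least `β`;
it therefore agrees with `log (2 / δ)` up to a factor that depends only on `β`.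

**Upper bound.** The algorithm is a knockout tournament. In the round with index `l` each duel is
decided by sampling both arms until the better one wins up to an error `ε_l` with probability at
least `1 - δ_l`, where `ε_l` and `δ_l` decrease geometrically with sums at most `ε` and `δ`. Start
from a best arm and pass, in every duel on the way, to the winner: the way meets a single duel per
round, so no union bound over the arms is needed, and the final winner is `ε`-optimal with
probability at least `1 - δ` (`Prog.expect_tournament_le`). The number of duels halves from round to
round, faster than the cost of a duel grows, so that the first round dominates the cost,
`O(n / ε² * log (1 / δ))` (`Prog.tournamentTime_le`). Adaptive strategies are written as decision
trees `Prog`, for which expectations are computed by recursion; `Prog.outputProb_toAlgorithm` says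
that a tree is realized by an `Algorithm` with the same output law.

**Lower bound.** Compare the instance with `n` fair coins to the `n` instances in which one coin has
mean `1 / 2 + ε`. On the latter only the biased arm is `ε`-optimal. The likelihood ratio `L_i` of the
`i`-th biased instance at the stopping time satisfies `∑ i, E[- log L_i] = κ E[T]`, where `κ` is the
Kullback-Leibler divergence of the coins, since every round contributes to exactly one of the `L_i`.
Conversely, `L_i` gives mass at least `1 - δ` to the output `i`, while under the fair coins the
probabilities of the `n` outputs add up to at most one. Bounding the logarithm by its tangent at
`n (1 - δ)` on the output `i`, and at `n δ / (n - 1)` otherwise, yields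
`κ E[T] ≥ (n - 1) log ((n - 1) / (n δ)) - log (n (1 - δ))` (`Algorithm.information_le_of_isPAC`),
and the last term absorbs only a fraction `2 / (2 + β)` of the main one. Everything is done at a
finite horizon first, so that neither almost sure stopping nor optional stopping enters.
-/

open MeasureTheory ProbabilityTheory
open scoped ENNReal

noncomputable section

namespace Bandit

variable {n : ℕ}

/-! ### The law of the first rounds -/

lemma measurable_finSnoc (t : ℕ) :
    Measurable fun p : (Fin t → Step n) × Step n =>
      (Fin.snoc (α := fun _ => Step n) p.1 p.2 : Fin (t + 1) → Step n) := by
  refine measurable_pi_lambda _ fun i => ?_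
  refine Fin.lastCases ?_ (fun j => ?_) i
  · simpa using measurable_snd
  · simpa [Function.comp_def] using (measurable_pi_apply j).comp measurable_fst

lemma hist_succ (t : ℕ) (ω : ℕ → Step n) :
    hist (t + 1) ω = Fin.snoc (α := fun _ => Step n) (hist t ω) (ω t) := by
  funext i
  refine Fin.lastCases ?_ (fun j => ?_) i <;> simp [hist]

namespace Algorithm

variable (A : Algorithm n) (ν : Instance n)

instance isProbabilityMeasure_firstStep : IsProbabilityMeasure (A.firstStep ν) := by
  unfold firstStep; infer_instance

instance isProbabilityMeasure_law : IsProbabilityMeasure (A.law ν) := by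
  unfold law; infer_instance

lemma law_map_zero : (A.law ν).map (fun ω => ω 0) = A.firstStep ν := by
  have h1 : (fun ω : ℕ → Step n => ω 0) =
      (fun x : Finset.Iic 0 → Step n => x ⟨0, Finset.mem_Iic.2 le_rfl⟩) ∘
        Preorder.frestrictLe (π := fun _ => Step n) 0 := rfl
  rw [law, Kernel.trajMeasure, h1, ← Measure.map_map (by fun_prop) (by fun_prop),
    Measure.map_comp _ _ (by fun_prop), Kernel.traj_map_frestrictLe, Kernel.partialTraj_self,
    Measure.id_comp, Measure.map_map (by fun_prop) (by fun_prop)]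
  exact Measure.map_id

/-- Given the first `t` rounds, the next arm is drawn from the policy and the reward from the
distribution of that arm. -/
lemma lintegral_hist_prod (t : ℕ) {f : (Fin t → Step n) × Step n → ℝ≥0∞} (hf : Measurable f) :
    ∫⁻ ω, f (hist t ω, ω t) ∂(A.law ν) =
      ∫⁻ ω, ∫⁻ a, ∫⁻ r, f (hist t ω, (a, r)) ∂(ν a : Measure ℝ) ∂(A.policy t (hist t ω))
        ∂(A.law ν) := by
  cases t with
  | zero =>
    have h0 : ∀ ω : ℕ → Step n, hist 0 ω = Fin.elim0 := fun ω => Subsingleton.elim _ _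
    simp_rw [h0]
    rw [lintegral_const, measure_univ, mul_one]
    have hg : Measurable fun x : Step n => f (Fin.elim0, x) := hf.comp measurable_prodMk_left
    rw [← lintegral_map (f := fun x : Step n => f (Fin.elim0, x)) (g := fun ω : ℕ → Step n => ω 0)
      hg (measurable_pi_apply 0), law_map_zero, firstStep, Measure.lintegral_compProd hg]
    rfl
  | succ t =>
    set e : (Finset.Iic t → Step n) → (Fin (t + 1) → Step n) := fun h i =>
      h ⟨(i : ℕ), Finset.mem_Iic.2 (Nat.lt_succ_iff.1 i.2)⟩
    have hem : Measurable e := measurable_pi_lambda _ fun _ => measurable_pi_apply _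
    have key := Kernel.map_frestrictLe_trajMeasure_compProd_eq_map_trajMeasure
      (X := fun _ => Step n) (μ₀ := A.firstStep ν) (κ := A.nextStep ν) (a := t)
    have hF : Measurable fun p : (Finset.Iic t → Step n) × Step n => f (e p.1, p.2) :=
      hf.comp ((hem.comp measurable_fst).prodMk measurable_snd)
    have h2 : ∫⁻ ω, f (hist (t + 1) ω, ω (t + 1)) ∂(A.law ν) =
        ∫⁻ p, f (e p.1, p.2) ∂((A.law ν).map
          (fun x => (Preorder.frestrictLe (π := fun _ => Step n) t x, x (t + 1)))) := by
      rw [lintegral_map hF (by fun_prop)]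
      rfl
    rw [h2, law, ← key, Measure.lintegral_compProd hF,
      lintegral_map (by exact hF.lintegral_kernel_prod_right') (by fun_prop)]
    refine lintegral_congr fun ω => ?_
    have hg : Measurable fun x : Step n =>
        f (e (Preorder.frestrictLe (π := fun _ => Step n) t ω), x) :=
      hf.comp measurable_prodMk_left
    rw [nextStep]
    exact Kernel.lintegral_compProd _ _ _ hg

end Algorithm

/-! ### Decision trees -/

/-- A decision tree that plays a bandit: either stop with a result, or pull an arm and continue
according to the reward. Rewards are read off only up to a rounding to integers; as every decision
then factors through countably many values, measurability never has to be checked. -/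
inductive Prog (n : ℕ) : Type
  | ret (a : Fin n) : Prog n
  | pull (i : Fin n) (k : ℤ → Prog n) : Prog n

namespace Prog

/-- Run a tree and continue with a tree that depends on its result. -/
def bind : Prog n → (Fin n → Prog n) → Prog n
  | ret a, g => g a
  | pull i k, g => pull i fun z => (k z).bind g

/-- The tree makes at most the given number of pulls on every branch. -/
def Within : Prog n → ℕ → Prop
  | ret _, _ => True
  | pull _ k, N => ∃ M, N = M + 1 ∧ ∀ z, (k z).Within M

/-- The expected value of `f` at the result of the tree, when rewards come from the instance `ν`
and are rounded down to multiples of `η`. -/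
def expect (ν : Instance n) (η : ℝ) : Prog n → (Fin n → ℝ≥0∞) → ℝ≥0∞
  | ret a, f => f a
  | pull i k, f => ∫⁻ r, (k ⌊r / η⌋).expect ν η f ∂(ν i : Measure ℝ)

/-- The tree that remains after one more (rounded) reward; trees that have stopped stay put. -/
def next : Prog n → ℤ → Prog n
  | ret a, _ => ret a
  | pull _ k, z => k z

/-- The arm pulled at the root of the tree; for a tree that has stopped, its result. -/
def head : Prog n → Fin n
  | ret a => a
  | pull i _ => i

/-- The tree that remains after `t` rounded rewards. -/
def run (p : Prog n) : (t : ℕ) → (Fin t → ℤ) → Prog n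
  | 0, _ => p
  | t + 1, z => (p.run t (Fin.init z)).next (z (Fin.last t))

lemma Within.mono {p : Prog n} {N M : ℕ} (h : p.Within N) (hNM : N ≤ M) : p.Within M := by
  induction p generalizing N M with
  | ret a => trivial
  | pull i k ih =>
    obtain ⟨N', rfl, h⟩ := h
    obtain ⟨M', rfl⟩ : ∃ M', M = M' + 1 := ⟨M - 1, by omega⟩
    exact ⟨M', rfl, fun z => ih z (h z) (by omega)⟩

lemma Within.bind {p : Prog n} {g : Fin n → Prog n} {N M : ℕ} (hp : p.Within N)
    (hg : ∀ a, (g a).Within M) : (p.bind g).Within (N + M) := by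
  induction p generalizing N with
  | ret a => exact (hg a).mono (by omega)
  | pull i k ih =>
    obtain ⟨N', rfl, hp⟩ := hp
    exact ⟨N' + M, by omega, fun z => ih z (hp z)⟩

lemma Within.next {p : Prog n} {N : ℕ} (hp : p.Within (N + 1)) (z : ℤ) : (p.next z).Within N := by
  cases p with
  | ret a => trivial
  | pull i k =>
    obtain ⟨N', hN, hp⟩ := hp
    obtain rfl : N = N' := by omega
    exact hp z

lemma Within.run {p : Prog n} {N t : ℕ} (hp : p.Within (N + t)) (z : Fin t → ℤ) :
    (p.run t z).Within N := by
  induction t generalizing N with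
  | zero => exact hp
  | succ t ih => exact (ih (N := N + 1) (by convert hp using 1; omega) _).next _

lemma Within.eq_ret {p : Prog n} (hp : p.Within 0) : p = ret p.head := by
  cases p with
  | ret a => rfl
  | pull i k =>
    obtain ⟨M, hM, -⟩ := hp
    omega

section expect

variable (ν : Instance n) (η : ℝ)

lemma expect_bind (p : Prog n) (g : Fin n → Prog n) (f : Fin n → ℝ≥0∞) :
    (p.bind g).expect ν η f = p.expect ν η fun a => (g a).expect ν η f := by
  induction p with
  | ret a => rfl
  | pull i k ih => simp [bind, expect, ih]

lemma expect_mono (p : Prog n) {f g : Fin n → ℝ≥0∞} (h : ∀ a, f a ≤ g a) :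
    p.expect ν η f ≤ p.expect ν η g := by
  induction p with
  | ret a => exact h a
  | pull i k ih => exact lintegral_mono fun r => ih _

lemma expect_const (p : Prog n) (c : ℝ≥0∞) : p.expect ν η (fun _ => c) = c := by
  induction p with
  | ret a => rfl
  | pull i k ih => simp [expect, ih]

lemma measurable_comp_floor (F : ℤ → ℝ≥0∞) : Measurable fun r : ℝ => F ⌊r / η⌋ :=
  (measurable_of_countable F).comp (Int.measurable_floor.comp (measurable_id.div_const η))

lemma expect_add (p : Prog n) (f g : Fin n → ℝ≥0∞) :
    p.expect ν η (fun a => f a + g a) = p.expect ν η f + p.expect ν η g := by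
  induction p with
  | ret a => rfl
  | pull i k ih =>
    simp only [expect, ih]
    exact lintegral_add_left (measurable_comp_floor η fun z => (k z).expect ν η f) _

lemma lintegral_expect_next (p : Prog n) (f : Fin n → ℝ≥0∞) :
    ∫⁻ r, (p.next ⌊r / η⌋).expect ν η f ∂(ν p.head : Measure ℝ) = p.expect ν η f := by
  cases p with
  | ret a => simp [next, expect]
  | pull i k => rfl

end expect

/-- The rounded rewards in a history. -/
def observe (η : ℝ) (t : ℕ) (h : Fin t → Step n) : Fin t → ℤ := fun s => ⌊(h s).2 / η⌋

lemma measurable_observe (η : ℝ) (t : ℕ) : Measurable (observe (n := n) η t) :=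
  measurable_pi_lambda _ fun s => Int.measurable_floor.comp
    ((measurable_snd.comp (measurable_pi_apply s)).div_const η)

/-- The algorithm that plays the tree `p`, using exactly `N` rounds. -/
def toAlgorithm (p : Prog n) (η : ℝ) (N : ℕ) : Algorithm n where
  policy t := Kernel.deterministic (fun h => (p.run t (observe η t h)).head)
    ((measurable_of_countable fun z => (p.run t z).head).comp (measurable_observe η t))
  markov_policy _ := inferInstance
  time _ := N
  isStoppingTime_time := isStoppingTime_const _ _
  output t := Kernel.deterministic (fun h => (p.run t (observe η t h)).head)
    ((measurable_of_countable fun z => (p.run t z).head).comp (measurable_observe η t))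
  markov_output _ := inferInstance

variable (ν : Instance n)

lemma lintegral_expect_run (p : Prog n) (η : ℝ) (N t : ℕ) (f : Fin n → ℝ≥0∞) :
    ∫⁻ ω, (p.run t (observe η t (hist t ω))).expect ν η f ∂((p.toAlgorithm η N).law ν) =
      p.expect ν η f := by
  induction t with
  | zero => simp [run]
  | succ t ih =>
    rw [← ih]
    let F : (Fin t → Step n) × Step n → ℝ≥0∞ := fun x =>
      ((p.run t (observe η t x.1)).next ⌊x.2.2 / η⌋).expect ν η f
    have hF : Measurable F :=
      (measurable_of_countable fun z : (Fin t → ℤ) × ℤ =>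
        ((p.run t z.1).next z.2).expect ν η f).comp
        (((measurable_observe η t).comp measurable_fst).prodMk (Int.measurable_floor.comp
          ((measurable_snd.comp measurable_snd).div_const η)))
    calc _ = ∫⁻ ω, F (hist t ω, ω t) ∂((p.toAlgorithm η N).law ν) := rfl
      _ = _ := Algorithm.lintegral_hist_prod _ ν t hF
      _ = _ := lintegral_congr fun ω => by
        simp only [toAlgorithm]
        rw [Kernel.lintegral_deterministic]
        exact lintegral_expect_next ν η _ f

lemma outputProb_toAlgorithm {p : Prog n} {N : ℕ} (hp : p.Within N) (η : ℝ) (S : Set (Fin n)) :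
    (p.toAlgorithm η N).outputProb ν S = p.expect ν η (S.indicator 1) := by
  rw [Algorithm.outputProb, tsum_eq_single N]
  · rw [← lintegral_expect_run ν p η N N]
    have h : {ω | (p.toAlgorithm η N).time ω = N} = Set.univ := Set.eq_univ_of_forall fun _ => rfl
    rw [h, setLIntegral_univ]
    refine lintegral_congr fun ω => ?_
    have h0 : (p.run N (observe η N (hist N ω))).Within 0 :=
      Within.run (by simpa using hp) _
    rw [h0.eq_ret]
    simp only [toAlgorithm, expect]
    rw [Kernel.deterministic_apply' _ _ (Set.toFinite S).measurableSet]
    rfl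
  · intro t ht
    have h : {ω | (p.toAlgorithm η N).time ω = t} = ∅ := by
      ext ω
      have : ¬ ((N : WithTop ℕ) = t) := fun h => ht (by exact_mod_cast h.symm)
      simpa [toAlgorithm] using this
    rw [h]; simp

lemma expectedTime_toAlgorithm (p : Prog n) (η : ℝ) (N : ℕ) :
    (p.toAlgorithm η N).expectedTime ν = N := by
  have : ∀ ω, (p.toAlgorithm η N).time ω = ((N : ℕ∞) : WithTop ℕ) := fun _ => rfl
  simp [Algorithm.expectedTime, this]

end Prog

/-! ### Hoeffding's inequality for rewards -/

/-- Hoeffding's lemma for a reward distribution on the unit interval. -/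
lemma lintegral_exp_mul_le {ρ : ProbabilityMeasure ℝ} (hρ : ρ ∈ unitRewards) (u : ℝ) :
    ∫⁻ r, ENNReal.ofReal (Real.exp (u * r)) ∂(ρ : Measure ℝ) ≤
      ENNReal.ofReal (Real.exp (u * ∫ r, r ∂(ρ : Measure ℝ) + u ^ 2 / 8)) := by
  set m := ∫ r, r ∂(ρ : Measure ℝ) with hm
  have h := hasSubgaussianMGF_of_mem_Icc (μ := (ρ : Measure ℝ)) (X := fun r => r)
    aemeasurable_id (a := 0) (b := 1) hρ
  have h1 := h.mgf_le u
  have hint := h.integrable_exp_mul u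
  have h2 : ∫⁻ r, ENNReal.ofReal (Real.exp (u * r)) ∂(ρ : Measure ℝ) =
      ENNReal.ofReal (Real.exp (u * m)) *
        ∫⁻ r, ENNReal.ofReal (Real.exp (u * (r - m))) ∂(ρ : Measure ℝ) := by
    rw [← lintegral_const_mul _ (by fun_prop)]
    refine lintegral_congr fun r => ?_
    rw [← ENNReal.ofReal_mul (Real.exp_pos _).le, ← Real.exp_add]
    ring_nf
  rw [h2, ← ofReal_integral_eq_lintegral_ofReal hint
    (Filter.Eventually.of_forall fun _ => (Real.exp_pos _).le),
    ← ENNReal.ofReal_mul (Real.exp_pos _).le, Real.exp_add]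
  refine ENNReal.ofReal_le_ofReal (mul_le_mul_of_nonneg_left (h1.trans (le_of_eq ?_))
    (Real.exp_pos _).le)
  congr 1
  simp
  ring

/-! ### Duels and tournaments -/

namespace Prog

/-- Compare the arms `x` and `y` by `s` pulls of each: `x` wins if its (rounded) total reward is at
least that of `y`. The integer `D` is the lead of `x` so far. -/
def duel (x y : Fin n) : ℕ → ℤ → Prog n
  | 0, D => ret (if 0 ≤ D then x else y)
  | s + 1, D => pull x fun a => pull y fun b => duel x y s (D + a - b)

lemma within_duel (x y : Fin n) (s : ℕ) (D : ℤ) : (duel x y s D).Within (2 * s) := by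
  induction s generalizing D with
  | zero => trivial
  | succ s ih =>
    exact ⟨2 * s + 1, by ring, fun a => ⟨2 * s, rfl, fun b => ih _⟩⟩

lemma expect_duel_le_of_le (ν : Instance n) (η : ℝ) (x y : Fin n) (s : ℕ) (D : ℤ)
    {f : Fin n → ℝ≥0∞} {c : ℝ≥0∞} (hx : f x ≤ c) (hy : f y ≤ c) :
    (duel x y s D).expect ν η f ≤ c := by
  induction s generalizing D with
  | zero => by_cases h : 0 ≤ D <;> simp [duel, expect, h, hx, hy]
  | succ s ih =>
    calc (duel x y (s + 1) D).expect ν η f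
        ≤ ∫⁻ _, ∫⁻ _, c ∂(ν y : Measure ℝ) ∂(ν x : Measure ℝ) :=
          lintegral_mono fun _ => lintegral_mono fun _ => ih _
      _ = c := by simp

/-- The exponential potential of the lead of an arm over an arm that is worse by `e` shrinks, in
expectation, by a constant factor per pair of pulls. The sign `σ` tells which of the two arms is
the better one. -/
lemma expect_duel_le_exp {ν : Instance n} (hν : ∀ i, ν i ∈ unitRewards) {η e σ : ℝ} (hη : 0 < η)
    (he : 0 < e) (hηe : η ≤ e / 4) (hσ : σ = 1 ∨ σ = -1) {x y : Fin n}
    (hxy : e ≤ σ * (ν.mean x - ν.mean y)) {f : Fin n → ℝ≥0∞}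
    (hf : ∀ D : ℤ, f (if 0 ≤ D then x else y) ≤ ENNReal.ofReal (Real.exp (-(σ * e * η * D))))
    (s : ℕ) (D : ℤ) :
    (duel x y s D).expect ν η f ≤
      ENNReal.ofReal (Real.exp (-(σ * e * η * D) - s * (e ^ 2 / 2))) := by
  induction s generalizing D with
  | zero => simpa [duel, expect] using hf D
  | succ s ih =>
    set c : ℝ := -(σ * e * η * D) - s * (e ^ 2 / 2) + e * η
    have hσ2 : σ ^ 2 = 1 := by rcases hσ with rfl | rfl <;> norm_num
    -- rounding costs at most `η` per pair of pulls, whichever the sign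
    have hround : ∀ r r' : ℝ, ENNReal.ofReal (Real.exp
        (-(σ * e * η * ((D + ⌊r / η⌋ - ⌊r' / η⌋ : ℤ) : ℝ)) - s * (e ^ 2 / 2))) ≤
        ENNReal.ofReal (Real.exp c) * (ENNReal.ofReal (Real.exp (-(σ * e) * r)) *
          ENNReal.ofReal (Real.exp (σ * e * r'))) := by
      intro r r'
      rw [← ENNReal.ofReal_mul (Real.exp_pos _).le, ← ENNReal.ofReal_mul (Real.exp_pos _).le,
        ← Real.exp_add, ← Real.exp_add]
      refine ENNReal.ofReal_le_ofReal (Real.exp_le_exp.2 ?_)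
      have h1 : η * ⌊r / η⌋ ≤ r := by
        have := mul_le_mul_of_nonneg_left (Int.floor_le (r / η)) hη.le
        rwa [mul_div_cancel₀ _ hη.ne'] at this
      have h2 : r ≤ η * ⌊r / η⌋ + η := by
        have := mul_le_mul_of_nonneg_left (Int.lt_floor_add_one (r / η)).le hη.le
        rw [mul_div_cancel₀ _ hη.ne'] at this
        linarith
      have h1' : η * ⌊r' / η⌋ ≤ r' := by
        have := mul_le_mul_of_nonneg_left (Int.floor_le (r' / η)) hη.le
        rwa [mul_div_cancel₀ _ hη.ne'] at this
      have h2' : r' ≤ η * ⌊r' / η⌋ + η := by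
        have := mul_le_mul_of_nonneg_left (Int.lt_floor_add_one (r' / η)).le hη.le
        rw [mul_div_cancel₀ _ hη.ne'] at this
        linarith
      have h3 : -σ * (η * ⌊r / η⌋ - η * ⌊r' / η⌋) ≤ -σ * (r - r') + η := by
        rcases hσ with rfl | rfl <;> linarith
      have h4 := mul_le_mul_of_nonneg_left h3 he.le
      push_cast
      simp only [c]
      linarith
    calc (duel x y (s + 1) D).expect ν η f
        ≤ ∫⁻ r, ∫⁻ r', ENNReal.ofReal (Real.exp c) *
            (ENNReal.ofReal (Real.exp (-(σ * e) * r)) * ENNReal.ofReal (Real.exp (σ * e * r')))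
            ∂(ν y : Measure ℝ) ∂(ν x : Measure ℝ) :=
          lintegral_mono fun r => lintegral_mono fun r' => (ih _).trans (hround r r')
      _ = ENNReal.ofReal (Real.exp c) *
            ((∫⁻ r, ENNReal.ofReal (Real.exp (-(σ * e) * r)) ∂(ν x : Measure ℝ)) *
              ∫⁻ r', ENNReal.ofReal (Real.exp (σ * e * r')) ∂(ν y : Measure ℝ)) := by
          rw [← lintegral_mul_const _ (by fun_prop), ← lintegral_const_mul _ (by fun_prop)]
          refine lintegral_congr fun r => ?_
          rw [lintegral_const_mul _ (by fun_prop), lintegral_const_mul _ (by fun_prop)]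
      _ ≤ ENNReal.ofReal (Real.exp c) *
            (ENNReal.ofReal (Real.exp (-(σ * e) * ν.mean x + (-(σ * e)) ^ 2 / 8)) *
              ENNReal.ofReal (Real.exp (σ * e * ν.mean y + (σ * e) ^ 2 / 8))) := by
          gcongr
          · exact lintegral_exp_mul_le (hν x) _
          · exact lintegral_exp_mul_le (hν y) _
      _ ≤ _ := by
          rw [← ENNReal.ofReal_mul (Real.exp_pos _).le, ← ENNReal.ofReal_mul (Real.exp_pos _).le,
            ← Real.exp_add, ← Real.exp_add]
          refine ENNReal.ofReal_le_ofReal (Real.exp_le_exp.2 ?_)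
          -- the exponent gains `-e ^ 2` from the gap, and loses at most `e ^ 2 / 4` to the rounding
          -- and `e ^ 2 / 4` to the fluctuations
          have h1 := mul_le_mul_of_nonneg_left hxy he.le
          have h2 := mul_le_mul_of_nonneg_left hηe he.le
          have h3 : (σ * e) ^ 2 = e ^ 2 := by rw [mul_pow, hσ2, one_mul]
          push_cast
          simp only [c, neg_sq, h3]
          nlinarith

/-- Whichever of the two arms in a duel one looks at, the winner is unlikely to be worse than that
arm by more than `e`. -/
lemma expect_duel_le {ν : Instance n} (hν : ∀ i, ν i ∈ unitRewards) {η e : ℝ} (hη : 0 < η)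
    (he : 0 < e) (hηe : η ≤ e / 4) {x y z : Fin n} (hz : z = x ∨ z = y) (s : ℕ) :
    (duel x y s 0).expect ν η ({a | ν.mean a + e < ν.mean z}.indicator 1) ≤
      ENNReal.ofReal (Real.exp (-(s * (e ^ 2 / 2)))) := by
  rcases hz with rfl | rfl
  · by_cases h : ν.mean y + e < ν.mean z
    · have := expect_duel_le_exp hν hη he hηe (σ := 1) (Or.inl rfl) (x := z) (y := y)
        (by linarith) (f := {a | ν.mean a + e < ν.mean z}.indicator 1) (fun D => ?_) s 0
      · simpa using this
      · by_cases hD : 0 ≤ D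
        · simp [hD, he.le]
        · have hD' : (D : ℝ) ≤ 0 := by exact_mod_cast (not_le.1 hD).le
          simp only [hD, if_false, Set.indicator, Set.mem_ofPred_eq, h, if_true, Pi.one_apply,
            ENNReal.one_le_ofReal, Real.one_le_exp_iff]
          have := mul_nonneg (mul_nonneg he.le hη.le) (neg_nonneg.2 hD')
          linarith
    · exact expect_duel_le_of_le _ _ _ _ _ _ (by simp [he.le]) (by simp [h])
  · by_cases h : ν.mean x + e < ν.mean z
    · have := expect_duel_le_exp hν hη he hηe (σ := -1) (Or.inr rfl) (x := x) (y := z)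
        (by linarith) (f := {a | ν.mean a + e < ν.mean z}.indicator 1) (fun D => ?_) s 0
      · simpa using this
      · by_cases hD : 0 ≤ D
        · have hD' : (0 : ℝ) ≤ D := by exact_mod_cast hD
          simp only [hD, Set.indicator, Set.mem_ofPred_eq, h, if_true, Pi.one_apply,
            ENNReal.one_le_ofReal, Real.one_le_exp_iff]
          have := mul_nonneg (mul_nonneg he.le hη.le) hD'
          linarith
        · simp [hD, he.le]
    · exact expect_duel_le_of_le _ _ _ _ _ _ (by simp [h]) (by simp [he.le])

/-- The knockout tournament among the `2 ^ l` arms `arm o, …, arm (o + 2 ^ l - 1)`, in which the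
duels of the round with index `j` use `s j` pulls of each arm. -/
def tournament (arm : ℕ → Fin n) (s : ℕ → ℕ) : ℕ → ℕ → Prog n
  | 0, o => ret (arm o)
  | l + 1, o => (tournament arm s l o).bind fun x =>
      (tournament arm s l (o + 2 ^ l)).bind fun y => duel x y (s l) 0

/-- The number of pulls in a tournament with `2 ^ l` participants. -/
def tournamentTime (s : ℕ → ℕ) : ℕ → ℕ
  | 0 => 0
  | l + 1 => tournamentTime s l + (tournamentTime s l + 2 * s l)

lemma within_tournament (arm : ℕ → Fin n) (s : ℕ → ℕ) (l o : ℕ) :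
    (tournament arm s l o).Within (tournamentTime s l) := by
  induction l generalizing o with
  | zero => trivial
  | succ l ih => exact (ih o).bind fun x => (ih _).bind fun y => within_duel x y _ _

lemma tournamentTime_le {s : ℕ → ℕ} {B : ℝ} (hs : ∀ l, (s l : ℝ) ≤ B * (15 / 8) ^ l) (l : ℕ) :
    (tournamentTime s l : ℝ) ≤ 16 * B * (2 ^ l - (15 / 8) ^ l) := by
  induction l with
  | zero => simp [tournamentTime]
  | succ l ih =>
    have := hs l
    push_cast [tournamentTime, pow_succ]
    linarith

/-- Follow the arm `arm (o + j)` through the tournament, passing to the winner of each duel played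
on the way. Only one duel per round is on that way, and if none of them is lost by too much, then
the final winner is almost as good as `arm (o + j)`. -/
lemma expect_tournament_le {ν : Instance n} (hν : ∀ i, ν i ∈ unitRewards) {η ε δ : ℝ}
    (hη : 0 < η) (hε : 0 < ε) (hδ : 0 < δ) (arm : ℕ → Fin n) {s : ℕ → ℕ}
    (hs : ∀ l, Real.exp (-(s l * ((ε / 5 * (4 / 5) ^ l) ^ 2 / 2))) ≤ δ * (1 / 2) ^ (l + 1))
    (l : ℕ) (hηl : η ≤ ε / 20 * (4 / 5) ^ l) (o j : ℕ) (hj : j < 2 ^ l) :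
    (tournament arm s l o).expect ν η
        ({a | ν.mean a + ε * (1 - (4 / 5) ^ l) < ν.mean (arm (o + j))}.indicator 1) ≤
      ENNReal.ofReal (δ * (1 - (1 / 2) ^ l)) := by
  induction l generalizing o j with
  | zero =>
    obtain rfl : j = 0 := by simpa using hj
    simp [tournament, expect]
  | succ l ih =>
    have hp : (0 : ℝ) < (4 / 5) ^ l := by positivity
    have hη' : η ≤ ε / 20 * (4 / 5) ^ l :=
      hηl.trans (by rw [pow_succ]; nlinarith [mul_pos hε hp])
    set e := ε / 5 * (4 / 5) ^ l with he_def
    have he : 0 < e := by positivity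
    have hηe : η ≤ e / 4 := by rw [he_def]; linarith
    have hhalf : ((1 : ℝ) / 2) ^ l ≤ 1 := pow_le_one₀ (by norm_num) (by norm_num)
    set f : Fin n → ℝ≥0∞ :=
      {a | ν.mean a + ε * (1 - (4 / 5) ^ (l + 1)) < ν.mean (arm (o + j))}.indicator 1 with hf
    set g : Fin n → ℝ≥0∞ :=
      {a | ν.mean a + ε * (1 - (4 / 5) ^ l) < ν.mean (arm (o + j))}.indicator 1 with hg
    have key : ∀ x y z : Fin n, z = x ∨ z = y → (duel x y (s l) 0).expect ν η f ≤
        ENNReal.ofReal (δ * (1 / 2) ^ (l + 1)) + g z := by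
      intro x y z hz
      by_cases h : ν.mean z + ε * (1 - (4 / 5) ^ l) < ν.mean (arm (o + j))
      · have h1 : g z = 1 := by simp only [hg, Set.indicator, Set.mem_ofPred_eq, h]; rfl
        rw [h1]
        refine (expect_duel_le_of_le ν η x y _ 0 (c := 1) ?_ ?_).trans le_add_self <;>
        exact Set.indicator_le_self _ _ _
      · refine le_trans ?_ ((expect_duel_le hν hη he hηe hz (s l)).trans
          ((ENNReal.ofReal_le_ofReal (hs l)).trans le_self_add))
        refine expect_mono ν η _ fun a => Set.indicator_le_indicator_of_subset ?_ (by simp) a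
        intro a ha
        simp only [Set.mem_ofPred_eq] at ha ⊢
        rw [pow_succ] at ha
        rw [he_def]
        linarith
    have hsum : ENNReal.ofReal (δ * (1 / 2) ^ (l + 1)) + ENNReal.ofReal (δ * (1 - (1 / 2) ^ l)) =
        ENNReal.ofReal (δ * (1 - (1 / 2) ^ (l + 1))) := by
      rw [← ENNReal.ofReal_add (by positivity) (mul_nonneg hδ.le (by linarith))]
      congr 1
      ring
    rw [← hsum]
    simp only [tournament, expect_bind]
    -- the arm that is followed plays in one half of the bracket; the other half is arbitrary
    by_cases hjl : j < 2 ^ l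
    · calc _ ≤ (tournament arm s l o).expect ν η
            fun x => ENNReal.ofReal (δ * (1 / 2) ^ (l + 1)) + g x :=
          expect_mono ν η _ fun x => (expect_mono ν η _ fun y => key x y x (Or.inl rfl)).trans
            (expect_const ν η _ _).le
        _ ≤ _ := by
          rw [expect_add, expect_const]
          gcongr
          exact ih hη' o j hjl
    · have hj' : o + j = o + 2 ^ l + (j - 2 ^ l) := by omega
      calc _ ≤ (tournament arm s l o).expect ν η fun _ =>
            (tournament arm s l (o + 2 ^ l)).expect ν η
              fun y => ENNReal.ofReal (δ * (1 / 2) ^ (l + 1)) + g y :=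
          expect_mono ν η _ fun x => expect_mono ν η _ fun y => key x y y (Or.inr rfl)
        _ ≤ _ := by
          rw [expect_const, expect_add, expect_const]
          gcongr
          rw [hg, hj']
          exact ih hη' (o + 2 ^ l) (j - 2 ^ l) (by rw [pow_succ] at hj; omega)

end Prog

/-! ### The upper bound -/

/-- In the round with index `l` the accuracy is `ε / 5 * (4 / 5) ^ l` and the failure probability is
`δ / 2 ^ (l + 1)`; both are summable. A number of pulls proportional to `(15 / 8) ^ l` is enough for
this, and since `15 / 8 < 2`, the total time is of the order of that of the first round. -/
lemma exp_neg_ceil_le {ε δ : ℝ} (hε : 0 < ε) (hδ : 0 < δ) (hδ1 : δ < 1) (l : ℕ) :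
    Real.exp (-(⌈250 * Real.log (2 / δ) / ε ^ 2 * (15 / 8) ^ l⌉₊ *
      ((ε / 5 * (4 / 5) ^ l) ^ 2 / 2))) ≤ δ * (1 / 2) ^ (l + 1) := by
  have hlog : 0 < Real.log (2 / δ) := Real.log_pos (by rw [lt_div_iff₀ hδ]; linarith)
  rw [← Real.le_log_iff_exp_le (by positivity)]
  have h1 := Nat.le_ceil (250 * Real.log (2 / δ) / ε ^ 2 * (15 / 8) ^ l)
  have h2 : Real.log (δ * (1 / 2) ^ (l + 1)) = Real.log δ - (l + 1) * Real.log 2 := by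
    rw [Real.log_mul hδ.ne' (by positivity), Real.log_pow, one_div, Real.log_inv]
    push_cast
    ring
  have h3 : Real.log (2 / δ) = Real.log 2 - Real.log δ := Real.log_div (by norm_num) hδ.ne'
  have h4 : (1 : ℝ) + l * (1 / 5) ≤ (6 / 5) ^ l := by
    have := one_add_mul_le_pow (a := (1 / 5 : ℝ)) (by norm_num) l
    norm_num at this ⊢
    exact this
  have h5 : 250 * Real.log (2 / δ) / ε ^ 2 * (15 / 8) ^ l * ((ε / 5 * (4 / 5) ^ l) ^ 2 / 2) =
      5 * Real.log (2 / δ) * (6 / 5) ^ l := by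
    have : ((6 : ℝ) / 5) ^ l = (15 / 8) ^ l * ((4 / 5) ^ l) ^ 2 := by
      rw [← pow_mul, mul_comm l 2, pow_mul, ← mul_pow]
      norm_num
    rw [this]
    field_simp
    ring
  have h6 : 250 * Real.log (2 / δ) / ε ^ 2 * (15 / 8) ^ l * ((ε / 5 * (4 / 5) ^ l) ^ 2 / 2) ≤
      ⌈250 * Real.log (2 / δ) / ε ^ 2 * (15 / 8) ^ l⌉₊ * ((ε / 5 * (4 / 5) ^ l) ^ 2 / 2) :=
    mul_le_mul_of_nonneg_right h1 (by positivity)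
  have h7 : Real.log δ < 0 := Real.log_neg hδ hδ1
  have h8 := mul_le_mul_of_nonneg_left h4 hlog.le
  have hl : (0 : ℝ) ≤ l := Nat.cast_nonneg l
  rw [h2]
  rw [h5] at h6
  have h10 : (l : ℝ) * Real.log δ ≤ 0 := mul_nonpos_of_nonneg_of_nonpos hl h7.le
  nlinarith [mul_nonneg hl hlog.le]

/-- Upper bound: a knockout tournament whose rounds get more and more accurate. -/
lemma sampleComplexity_le {𝒟 : Set (ProbabilityMeasure ℝ)} (h𝒟 : 𝒟 ⊆ unitRewards) {ε δ : ℝ}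
    (hn : 2 ≤ n) (hε : 0 < ε) (hε2 : ε ≤ 1 / 2) (hδ : 0 < δ) (hδ1 : δ < 1) :
    sampleComplexity 𝒟 n ε δ ≤ ENNReal.ofReal (8032 * n * Real.log (2 / δ) / ε ^ 2) := by
  have : NeZero n := ⟨by omega⟩
  have hlog2 : Real.log 2 ≤ Real.log (2 / δ) :=
    Real.log_le_log (by norm_num) (by rw [le_div_iff₀ hδ]; linarith)
  have hlog : 1 / 2 ≤ Real.log (2 / δ) := by linarith [Real.log_two_gt_d9]
  set B : ℝ := 250 * Real.log (2 / δ) / ε ^ 2 with hB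
  set s : ℕ → ℕ := fun l => ⌈B * (15 / 8) ^ l⌉₊ with hs
  -- round the number of arms up to a power of two; some arms then take part more than once
  set k := Nat.clog 2 n
  set η : ℝ := ε / 20 * (4 / 5) ^ k
  have hη : 0 < η := by positivity
  set arm : ℕ → Fin n := fun i => Fin.ofNat n i
  set p := Prog.tournament arm s k 0 with hp
  set N := Prog.tournamentTime s k
  have hnk : n ≤ 2 ^ k := Nat.le_pow_clog (by norm_num) n
  have hkn : 2 ^ k ≤ 2 * n := by
    have h1 := Nat.pow_pred_clog_lt_self (b := 2) (x := n) (by norm_num) (by omega)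
    have h2 : 0 < k := Nat.clog_pos (by norm_num) hn
    have h3 : 2 ^ k = 2 * 2 ^ k.pred := by
      conv_lhs => rw [← Nat.succ_pred_eq_of_pos h2, pow_succ, mul_comm]
    rw [h3]
    exact Nat.mul_le_mul_left 2 h1.le
  refine (iInf₂_le (p.toAlgorithm η N) ?_).trans ?_
  · intro ν hν
    have hν' : ∀ i, ν i ∈ unitRewards := fun i => h𝒟 (hν i)
    rw [Prog.outputProb_toAlgorithm ν (Prog.within_tournament arm s k 0)]
    obtain ⟨i, hi⟩ : ∃ i, ∀ j, ν.mean j ≤ ν.mean i := Finite.exists_max ν.mean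
    have hsup : ⨆ j, ν.mean j = ν.mean i :=
      le_antisymm (ciSup_le hi) (le_ciSup (Set.finite_range _).bddAbove i)
    have hbad := Prog.expect_tournament_le hν' hη hε hδ arm (s := s)
      (fun l => exp_neg_ceil_le hε hδ hδ1 l) k le_rfl 0 i (i.2.trans_le hnk)
    have harm : arm (0 + i) = i := by
      simp [arm]
    rw [harm] at hbad
    have hhalf : (0 : ℝ) < (1 / 2) ^ k := by positivity
    have hq : (0 : ℝ) < (4 / 5) ^ k := by positivity
    have hle : (1 : ℝ≥0∞) ≤ p.expect ν η ({a | ν.IsOptimal ε a}.indicator 1) +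
        ENNReal.ofReal δ := by
      calc (1 : ℝ≥0∞) = p.expect ν η (fun _ => 1) := (Prog.expect_const ν η p 1).symm
        _ ≤ p.expect ν η (fun a => {a | ν.IsOptimal ε a}.indicator 1 a +
            {a | ν.mean a + ε * (1 - (4 / 5) ^ k) < ν.mean i}.indicator 1 a) := by
          refine Prog.expect_mono ν η p fun a => ?_
          by_cases ha : ν.mean a + ε * (1 - (4 / 5) ^ k) < ν.mean i
          · simp [Set.indicator, ha]
          · have : ν.IsOptimal ε a := by
              rw [Instance.IsOptimal, hsup]
              nlinarith [mul_pos hε hq]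
            simp [Set.indicator, this]
        _ ≤ _ := by
          rw [Prog.expect_add]
          gcongr
          exact hbad.trans (ENNReal.ofReal_le_ofReal (by nlinarith))
    rw [ENNReal.ofReal_sub _ hδ.le, ENNReal.ofReal_one]
    exact tsub_le_iff_right.2 hle
  · refine iSup₂_le fun ν _ => ?_
    rw [Prog.expectedTime_toAlgorithm, ← ENNReal.ofReal_natCast]
    refine ENNReal.ofReal_le_ofReal ?_
    have hB1 : ∀ l, (s l : ℝ) ≤ (B + 1) * (15 / 8) ^ l := by
      intro l
      have h1 : (1 : ℝ) ≤ (15 / 8) ^ l := one_le_pow₀ (by norm_num)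
      have h2 := (Nat.ceil_lt_add_one (a := B * (15 / 8) ^ l) (by positivity)).le
      simp only [hs]
      linarith
    have h1 := Prog.tournamentTime_le hB1 k
    have h2 : B + 1 ≤ 251 * Real.log (2 / δ) / ε ^ 2 := by
      have : 1 ≤ Real.log (2 / δ) / ε ^ 2 := by
        rw [le_div_iff₀ (by positivity)]
        nlinarith
      rw [hB]
      linarith [mul_div_assoc 250 (Real.log (2 / δ)) (ε ^ 2),
        mul_div_assoc 251 (Real.log (2 / δ)) (ε ^ 2)]
    have h3 : (2 : ℝ) ^ k ≤ 2 * n := by exact_mod_cast hkn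
    have h4 : (0 : ℝ) < (15 / 8) ^ k := by positivity
    have hB0 : 0 < B + 1 := by positivity
    calc (N : ℝ) ≤ 16 * (B + 1) * (2 ^ k - (15 / 8) ^ k) := h1
      _ ≤ 16 * (B + 1) * (2 * n) := by gcongr; linarith
      _ ≤ 16 * (251 * Real.log (2 / δ) / ε ^ 2) * (2 * n) := by gcongr
      _ = _ := by ring

/-! ### Change of measure up to a stopping time -/

namespace Algorithm

variable (A : Algorithm n)

/-- Change of measure up to a fixed time: if the reward distributions of `ν` have density `l`
with respect to those of `ν₀`, then the likelihood ratio of the first `t` rounds is the product of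
the densities of these rounds. -/
lemma lintegral_hist_eq_mul_prod {ν ν₀ : Instance n} {l : Step n → ℝ≥0∞} (hl : Measurable l)
    (hν : ∀ a (g : ℝ → ℝ≥0∞), Measurable g →
      ∫⁻ r, g r ∂(ν a : Measure ℝ) = ∫⁻ r, g r * l (a, r) ∂(ν₀ a : Measure ℝ))
    (t : ℕ) {G : (Fin t → Step n) → ℝ≥0∞} (hG : Measurable G) :
    ∫⁻ ω, G (hist t ω) ∂(A.law ν) =
      ∫⁻ ω, G (hist t ω) * ∏ s : Fin t, l (hist t ω s) ∂(A.law ν₀) := by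
  induction t with
  | zero =>
    have h0 : ∀ ω : ℕ → Step n, hist 0 ω = Fin.elim0 := fun ω => Subsingleton.elim _ _
    simp [h0]
  | succ t ih =>
    let F : (Fin t → Step n) × Step n → ℝ≥0∞ := fun p =>
      G (Fin.snoc (α := fun _ => Step n) p.1 p.2)
    have hF : Measurable F := hG.comp (measurable_finSnoc t)
    let F' : (Fin t → Step n) × Step n → ℝ≥0∞ := fun p =>
      F p * ((∏ s : Fin t, l (p.1 s)) * l p.2)
    have hprod : Measurable fun h : Fin t → Step n => ∏ s : Fin t, l (h s) :=
      Finset.measurable_prod _ fun s _ => hl.comp (measurable_pi_apply s)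
    have hF' : Measurable F' :=
      hF.mul ((hprod.comp measurable_fst).mul (hl.comp measurable_snd))
    let G' : (Fin t → Step n) → ℝ≥0∞ := fun h =>
      ∫⁻ a, ∫⁻ r, F (h, (a, r)) ∂(ν a : Measure ℝ) ∂(A.policy t h)
    have hG' : Measurable G' := by
      have h1 : Measurable fun q : (Fin t → Step n) × Fin n =>
          ∫⁻ r, F (q.1, (q.2, r)) ∂(Kernel.prodMkLeft (Fin t → Step n) ν.rewardKernel q) :=
        Measurable.lintegral_kernel_prod_right'
          (f := fun x : ((Fin t → Step n) × Fin n) × ℝ => F (x.1.1, (x.1.2, x.2)))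
          (hF.comp (by fun_prop))
      exact h1.lintegral_kernel_prod_right'
    calc ∫⁻ ω, G (hist (t + 1) ω) ∂(A.law ν) = ∫⁻ ω, F (hist t ω, ω t) ∂(A.law ν) :=
          lintegral_congr fun ω => by rw [hist_succ]
      _ = ∫⁻ ω, G' (hist t ω) ∂(A.law ν) := A.lintegral_hist_prod ν t hF
      _ = ∫⁻ ω, G' (hist t ω) * ∏ s : Fin t, l (hist t ω s) ∂(A.law ν₀) := ih hG'
      _ = ∫⁻ ω, F' (hist t ω, ω t) ∂(A.law ν₀) := by
          rw [A.lintegral_hist_prod ν₀ t hF']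
          refine lintegral_congr fun ω => ?_
          rw [← lintegral_mul_const _ (measurable_of_countable _)]
          refine lintegral_congr fun a => ?_
          have hm : Measurable fun r => F (hist t ω, (a, r)) := hF.comp (by fun_prop)
          have hm2 : Measurable fun r => l (a, r) := hl.comp (by fun_prop)
          have hm3 : Measurable fun r => F (hist t ω, (a, r)) * l (a, r) := hm.mul hm2
          rw [hν a _ hm, ← lintegral_mul_const _ hm3]
          refine lintegral_congr fun r => ?_
          simp only [F']
          ring
      _ = _ := lintegral_congr fun ω => by
          rw [hist_succ, Fin.prod_univ_castSucc]
          simp [F', F]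

lemma measurableSet_of_history {t : ℕ} {D : Set (ℕ → Step n)}
    (hD : MeasurableSet[historyFiltration n t] D) : MeasurableSet D :=
  (historyFiltration n).le t _ hD

/-- The change of measure on an event known at time `t`. -/
lemma setLIntegral_hist_eq_mul_prod {ν ν₀ : Instance n} {l : Step n → ℝ≥0∞} (hl : Measurable l)
    (hν : ∀ a (g : ℝ → ℝ≥0∞), Measurable g →
      ∫⁻ r, g r ∂(ν a : Measure ℝ) = ∫⁻ r, g r * l (a, r) ∂(ν₀ a : Measure ℝ))
    {t : ℕ} {D : Set (ℕ → Step n)} (hD : MeasurableSet[historyFiltration n t] D)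
    {G : (Fin t → Step n) → ℝ≥0∞} (hG : Measurable G) :
    ∫⁻ ω in D, G (hist t ω) ∂(A.law ν) =
      ∫⁻ ω in D, G (hist t ω) * ∏ s ∈ Finset.range t, l (ω s) ∂(A.law ν₀) := by
  have hD' := measurableSet_of_history hD
  obtain ⟨S, hS, rfl⟩ := hD
  rw [← lintegral_indicator hD', ← lintegral_indicator hD']
  refine Eq.trans ?_ ((A.lintegral_hist_eq_mul_prod hl hν t (hG.indicator hS)).trans ?_)
  · rfl
  · refine lintegral_congr fun ω => ?_
    have h1 : ∏ s : Fin t, l (hist t ω s) = ∏ s ∈ Finset.range t, l (ω s) :=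
      Fin.prod_univ_eq_prod_range (fun s => l (ω s)) t
    rw [h1]
    by_cases h : hist t ω ∈ S <;> simp [Set.indicator, h]

/-- A reward is independent of the past if all the arms have the same reward distribution. -/
lemma setLIntegral_reward {ν₀ : Instance n} {ρ : ProbabilityMeasure ℝ} (hν₀ : ∀ a, ν₀ a = ρ)
    {t : ℕ} {D : Set (ℕ → Step n)} (hD : MeasurableSet[historyFiltration n t] D)
    {g : ℝ → ℝ≥0∞} (hg : Measurable g) :
    ∫⁻ ω in D, g (ω t).2 ∂(A.law ν₀) = A.law ν₀ D * ∫⁻ r, g r ∂(ρ : Measure ℝ) := by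
  have hD' := measurableSet_of_history hD
  obtain ⟨S, hS, rfl⟩ := hD
  have hF : Measurable fun p : (Fin t → Step n) × Step n => S.indicator 1 p.1 * g p.2.2 :=
    ((measurable_one.indicator hS).comp measurable_fst).mul
      (hg.comp (measurable_snd.comp measurable_snd))
  calc ∫⁻ ω in hist t ⁻¹' S, g (ω t).2 ∂(A.law ν₀)
      = ∫⁻ ω, S.indicator 1 (hist t ω) * g (ω t).2 ∂(A.law ν₀) := by
        rw [← lintegral_indicator hD']
        refine lintegral_congr fun ω => ?_
        by_cases h : hist t ω ∈ S <;> simp [Set.indicator, h]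
    _ = _ := A.lintegral_hist_prod ν₀ t hF
    _ = ∫⁻ ω, (hist t ⁻¹' S).indicator 1 ω * ∫⁻ r, g r ∂(ρ : Measure ℝ) ∂(A.law ν₀) := by
        refine lintegral_congr fun ω => ?_
        simp_rw [hν₀, lintegral_const_mul _ hg]
        by_cases h : hist t ω ∈ S <;> simp [Set.indicator, h]
    _ = _ := by
        rw [lintegral_mul_const _ (measurable_one.indicator hD'), lintegral_indicator_one hD']

/-- The likelihood ratio of the rounds before time `m` that are played. -/
def stoppedLikelihood (l : Step n → ℝ) (m : ℕ) (ω : ℕ → Step n) : ℝ :=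
  ∏ s ∈ Finset.range m, if (s : WithTop ℕ) < A.time ω then l (ω s) else 1

lemma measurableSet_lt_time (s : ℕ) :
    MeasurableSet[historyFiltration n s] {ω | (s : WithTop ℕ) < A.time ω} :=
  A.isStoppingTime_time.measurableSet_gt s

lemma measurableSet_time_eq (s : ℕ) :
    MeasurableSet[historyFiltration n s] {ω | A.time ω = s} :=
  A.isStoppingTime_time.measurableSet_eq s

lemma measurableSet_le_time (s : ℕ) :
    MeasurableSet[historyFiltration n s] {ω | (s : WithTop ℕ) ≤ A.time ω} :=
  A.isStoppingTime_time.measurableSet_ge s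

lemma measurable_stoppedLikelihood {l : Step n → ℝ} (hl : Measurable l) (m : ℕ) :
    Measurable (A.stoppedLikelihood l m) :=
  Finset.measurable_prod _ fun s _ => Measurable.ite
    (measurableSet_of_history (A.measurableSet_lt_time s)) (hl.comp (measurable_pi_apply s))
    measurable_const

lemma stoppedLikelihood_of_le {l : Step n → ℝ} {m : ℕ} {ω : ℕ → Step n}
    (h : (m : WithTop ℕ) ≤ A.time ω) :
    A.stoppedLikelihood l m ω = ∏ s ∈ Finset.range m, l (ω s) := by
  refine Finset.prod_congr rfl fun s hs => if_pos (lt_of_lt_of_le ?_ h)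
  exact_mod_cast Finset.mem_range.1 hs

lemma stoppedLikelihood_of_eq {l : Step n → ℝ} {m t : ℕ} (htm : t ≤ m) {ω : ℕ → Step n}
    (h : A.time ω = t) : A.stoppedLikelihood l m ω = ∏ s ∈ Finset.range t, l (ω s) := by
  have h1 : ∀ s : ℕ, (s : WithTop ℕ) < A.time ω ↔ s < t := fun s => by rw [h]; norm_cast
  simp only [stoppedLikelihood, h1]
  rw [← Finset.prod_subset (Finset.range_mono htm) fun s _ hs => if_neg (by simpa using hs)]
  exact Finset.prod_congr rfl fun s hs => if_pos (Finset.mem_range.1 hs)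

lemma stoppedLikelihood_pos {l : Step n → ℝ} (hl : ∀ x, 0 < l x) (m : ℕ) (ω : ℕ → Step n) :
    0 < A.stoppedLikelihood l m ω :=
  Finset.prod_pos fun s _ => by split_ifs <;> simp [hl]

lemma stoppedLikelihood_le {l : Step n → ℝ} (hl : ∀ x, 0 < l x) (hl2 : ∀ x, l x ≤ 2) (m : ℕ)
    (ω : ℕ → Step n) : A.stoppedLikelihood l m ω ≤ 2 ^ m := by
  calc A.stoppedLikelihood l m ω ≤ ∏ s ∈ Finset.range m, (2 : ℝ) :=
        Finset.prod_le_prod (fun s _ => by split_ifs <;> simp [(hl _).le])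
          fun s _ => by split_ifs <;> [exact hl2 _; norm_num]
    _ = 2 ^ m := by simp

lemma log_stoppedLikelihood {l : Step n → ℝ} (hl : ∀ x, 0 < l x) (m : ℕ) (ω : ℕ → Step n) :
    Real.log (A.stoppedLikelihood l m ω) =
      ∑ s ∈ Finset.range m, if (s : WithTop ℕ) < A.time ω then Real.log (l (ω s)) else 0 := by
  rw [stoppedLikelihood, Real.log_prod fun s _ => by split_ifs <;> simp [(hl _).ne']]
  exact Finset.sum_congr rfl fun s _ => by split_ifs <;> simp

/-- Split an integral according to the value of the stopping time up to the horizon `m`. -/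
lemma lintegral_eq_sum_time (P : Measure (ℕ → Step n)) (m : ℕ) (f : (ℕ → Step n) → ℝ≥0∞) :
    ∫⁻ ω, f ω ∂P = ∫⁻ ω in {ω | (m : WithTop ℕ) ≤ A.time ω}, f ω ∂P +
      ∑ t ∈ Finset.range m, ∫⁻ ω in {ω | A.time ω = t}, f ω ∂P := by
  rw [← lintegral_add_compl f (measurableSet_of_history (A.measurableSet_le_time m)),
    ← lintegral_biUnion_finset]
  · congr 3
    ext ω
    simp only [Set.mem_compl_iff, Set.mem_ofPred_eq, not_le, Set.mem_iUnion, Finset.mem_range,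
      exists_prop]
    constructor
    · intro h
      obtain ⟨t, ht⟩ := WithTop.ne_top_iff_exists.1 (ne_top_of_lt h)
      exact ⟨t, by rw [← ht] at h; exact WithTop.coe_lt_coe.1 h, ht.symm⟩
    · rintro ⟨t, ht, h⟩
      rw [h]
      exact_mod_cast ht
  · intro s _ t _ hst
    refine Set.disjoint_left.2 fun ω h1 h2 => hst ?_
    have h3 : (s : WithTop ℕ) = t := by rw [← show A.time ω = s from h1]; exact h2
    exact_mod_cast h3
  · exact fun t _ => measurableSet_of_history (A.measurableSet_time_eq t)

/-- The change of measure on an event on which only the first `t` rounds are played before time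
`m`. -/
lemma setLIntegral_mul_stoppedLikelihood {ν ν₀ : Instance n} {l : Step n → ℝ} (hl : Measurable l)
    (hl0 : ∀ x, 0 < l x)
    (hν : ∀ a (g : ℝ → ℝ≥0∞), Measurable g →
      ∫⁻ r, g r ∂(ν a : Measure ℝ) = ∫⁻ r, g r * ENNReal.ofReal (l (a, r)) ∂(ν₀ a : Measure ℝ))
    {t m : ℕ} {D : Set (ℕ → Step n)}
    (hD : MeasurableSet[historyFiltration n t] D)
    (hDl : ∀ ω ∈ D, A.stoppedLikelihood l m ω = ∏ s ∈ Finset.range t, l (ω s))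
    {G : (Fin t → Step n) → ℝ≥0∞} (hG : Measurable G) :
    ∫⁻ ω in D, G (hist t ω) * ENNReal.ofReal (A.stoppedLikelihood l m ω) ∂(A.law ν₀) =
      ∫⁻ ω in D, G (hist t ω) ∂(A.law ν) := by
  rw [A.setLIntegral_hist_eq_mul_prod hl.ennreal_ofReal hν hD hG]
  refine setLIntegral_congr_fun (measurableSet_of_history hD) fun ω hω => ?_
  simp only [hDl ω hω, ENNReal.ofReal_prod_of_nonneg fun s _ => (hl0 _).le]

lemma lintegral_stoppedLikelihood {ν ν₀ : Instance n} {l : Step n → ℝ} (hl : Measurable l)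
    (hl0 : ∀ x, 0 < l x)
    (hν : ∀ a (g : ℝ → ℝ≥0∞), Measurable g →
      ∫⁻ r, g r ∂(ν a : Measure ℝ) = ∫⁻ r, g r * ENNReal.ofReal (l (a, r)) ∂(ν₀ a : Measure ℝ))
    (m : ℕ) :
    ∫⁻ ω, ENNReal.ofReal (A.stoppedLikelihood l m ω) ∂(A.law ν₀) = 1 := by
  have h1 : ∫⁻ _, 1 ∂(A.law ν) = 1 := by simp
  rw [A.lintegral_eq_sum_time (A.law ν) m] at h1
  rw [A.lintegral_eq_sum_time (A.law ν₀) m, ← h1]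
  refine congrArg₂ (· + ·) ?_ (Finset.sum_congr rfl fun t ht => ?_)
  · have h2 := A.setLIntegral_mul_stoppedLikelihood hl hl0 hν (A.measurableSet_le_time m)
      (fun ω hω => A.stoppedLikelihood_of_le hω) (G := fun _ => 1) measurable_const
    simpa only [one_mul] using h2
  · have h2 := A.setLIntegral_mul_stoppedLikelihood hl hl0 hν (A.measurableSet_time_eq t)
      (fun ω hω => A.stoppedLikelihood_of_eq (Finset.mem_range.1 ht).le hω) (G := fun _ => 1)
      measurable_const
    simpa only [one_mul] using h2

/-- The conditional probability, given all rounds, of stopping before time `m` with output `i`. -/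
def outputBefore (i : Fin n) (m : ℕ) (ω : ℕ → Step n) : ℝ≥0∞ :=
  ∑ t ∈ Finset.range m, {ω | A.time ω = t}.indicator (fun ω => A.output t (hist t ω) {i}) ω

lemma measurable_output (i : Fin n) (t : ℕ) :
    Measurable fun h : Fin t → Step n => A.output t h {i} :=
  Kernel.measurable_coe _ (measurableSet_singleton i)

lemma measurable_outputBefore (i : Fin n) (m : ℕ) : Measurable (A.outputBefore i m) :=
  Finset.measurable_sum _ fun t _ => ((A.measurable_output i t).comp (measurable_hist t)).indicator
    (measurableSet_of_history (A.measurableSet_time_eq t))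

lemma sum_outputBefore_le_one (m : ℕ) (ω : ℕ → Step n) : ∑ i, A.outputBefore i m ω ≤ 1 := by
  simp only [outputBefore]
  rw [Finset.sum_comm]
  have h1 : ∀ t : ℕ, ∑ i, {ω | A.time ω = t}.indicator (fun ω => A.output t (hist t ω) {i}) ω =
      {ω | A.time ω = t}.indicator 1 ω := by
    intro t
    by_cases h : A.time ω = t
    · simp only [Set.indicator, Set.mem_ofPred_eq, h, if_true, Pi.one_apply]
      rw [sum_measure_singleton]
      simp
    · simp [Set.indicator, h]
  simp only [h1]
  by_cases h : ∃ t : ℕ, A.time ω = t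
  · obtain ⟨t, ht⟩ := h
    calc _ ≤ ∑ s ∈ Finset.range m, if s = t then (1 : ℝ≥0∞) else 0 := by
          refine Finset.sum_le_sum fun s _ => ?_
          by_cases hs : s = t
          · simp [hs, Set.indicator, ht]
          · have : ¬ ((t : WithTop ℕ) = s) := fun h => hs (by exact_mod_cast h.symm)
            simp [Set.indicator, ht, this]
      _ ≤ 1 := by
          rw [Finset.sum_ite_eq']
          split_ifs <;> simp
  · push Not at h
    simp [Set.indicator, h]

lemma outputBefore_le_one (i : Fin n) (m : ℕ) (ω : ℕ → Step n) : A.outputBefore i m ω ≤ 1 :=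
  (Finset.single_le_sum (f := fun i => A.outputBefore i m ω) (fun _ _ => zero_le)
    (Finset.mem_univ i)).trans (A.sum_outputBefore_le_one m ω)

lemma lintegral_outputBefore_mul (P : Measure (ℕ → Step n)) (i : Fin n) (m : ℕ)
    {f : (ℕ → Step n) → ℝ≥0∞} (hf : Measurable f) :
    ∫⁻ ω, A.outputBefore i m ω * f ω ∂P =
      ∑ t ∈ Finset.range m, ∫⁻ ω in {ω | A.time ω = t}, A.output t (hist t ω) {i} * f ω ∂P := by
  simp only [outputBefore, Finset.sum_mul]
  rw [lintegral_finsetSum]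
  · refine Finset.sum_congr rfl fun t _ => ?_
    rw [← lintegral_indicator (measurableSet_of_history (A.measurableSet_time_eq t))]
    refine lintegral_congr fun ω => ?_
    by_cases h : A.time ω = t <;> simp [Set.indicator, h]
  · exact fun t _ => (((A.measurable_output i t).comp (measurable_hist t)).indicator
      (measurableSet_of_history (A.measurableSet_time_eq t))).mul hf

lemma tendsto_sum_outputProb (ν : Instance n) (i : Fin n) :
    Filter.Tendsto (fun m => ∑ t ∈ Finset.range m,
      ∫⁻ ω in {ω | A.time ω = t}, A.output t (hist t ω) {i} ∂(A.law ν)) Filter.atTop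
      (nhds (A.outputProb ν {i})) :=
  ENNReal.tendsto_nat_tsum _

lemma outputProb_mono (ν : Instance n) {S S' : Set (Fin n)} (h : S ⊆ S') :
    A.outputProb ν S ≤ A.outputProb ν S' :=
  ENNReal.tsum_le_tsum fun _ => lintegral_mono fun _ => measure_mono h

lemma sum_measure_lt_time_le (ν : Instance n) (m : ℕ) :
    ∑ s ∈ Finset.range m, A.law ν {ω | (s : WithTop ℕ) < A.time ω} ≤ A.expectedTime ν := by
  have hm : ∀ s : ℕ, MeasurableSet {ω | (s : WithTop ℕ) < A.time ω} := fun s =>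
    measurableSet_of_history (A.measurableSet_lt_time s)
  calc _ = ∑ s ∈ Finset.range m,
        ∫⁻ ω, {ω | (s : WithTop ℕ) < A.time ω}.indicator 1 ω ∂(A.law ν) :=
        Finset.sum_congr rfl fun s _ => (lintegral_indicator_one (hm s)).symm
    _ = ∫⁻ ω, ∑ s ∈ Finset.range m, {ω | (s : WithTop ℕ) < A.time ω}.indicator 1 ω ∂(A.law ν) :=
        (lintegral_finsetSum _ fun s _ => measurable_one.indicator (hm s)).symm
    _ ≤ _ := by
        refine lintegral_mono fun ω => ?_
        simp only [Set.indicator, Set.mem_ofPred_eq, Pi.one_apply, Finset.sum_boole]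
        rcases h : A.time ω with _ | t
        · exact le_top
        · have h2 : ∀ s : ℕ, ((s : WithTop ℕ) < WithTop.some t) ↔ s < t := fun s =>
            WithTop.coe_lt_coe
          have h3 : (Finset.range m).filter (fun s => s < t) ⊆ Finset.range t := fun s hs =>
            Finset.mem_range.2 (Finset.mem_filter.1 hs).2
          have h4 := Finset.card_le_card h3
          rw [Finset.card_range] at h4
          calc _ ≤ ((t : ℕ) : ℝ≥0∞) := by
                simp only [WithTop.some_eq_coe, h2]
                exact_mod_cast h4
            _ = ENat.toENNReal ((t : ℕ) : ℕ∞) := by simp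
            _ = _ := rfl

end Algorithm

/-! ### Hard instances -/

/-- The Bernoulli reward distribution with mean `p`. -/
def bernoulliReward (p : unitInterval) : ProbabilityMeasure ℝ :=
  ⟨bernoulliMeasure 1 0 p, inferInstance⟩

lemma bernoulliReward_mem (p : unitInterval) : bernoulliReward p ∈ bernoulliRewards := ⟨p, rfl⟩

lemma lintegral_bernoulliReward (p : unitInterval) (g : ℝ → ℝ≥0∞) :
    ∫⁻ r, g r ∂(bernoulliReward p : Measure ℝ) =
      ENNReal.ofReal p * g 1 + ENNReal.ofReal (1 - p) * g 0 := by
  have h1 : ((unitInterval.toNNReal p : NNReal) : ℝ≥0∞) = ENNReal.ofReal p := by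
    rw [← ENNReal.ofReal_coe_nnreal]; rfl
  have h2 : ((unitInterval.toNNReal (unitInterval.symm p) : NNReal) : ℝ≥0∞) =
      ENNReal.ofReal (1 - p) := by
    rw [← ENNReal.ofReal_coe_nnreal]; rfl
  change ∫⁻ r, g r ∂(bernoulliMeasure 1 0 p) = _
  rw [bernoulliMeasure_def, lintegral_add_measure]
  simp only [lintegral_smul_measure, lintegral_dirac, ENNReal.smul_def, smul_eq_mul, h1, h2]

lemma integral_bernoulliReward (p : unitInterval) :
    ∫ r, r ∂(bernoulliReward p : Measure ℝ) = p := by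
  change ∫ r, r ∂(bernoulliMeasure 1 0 p) = _
  rw [integral_bernoulliMeasure]
  simp

/-- The parameter `1 / 2 + ε` (projected to the unit interval). -/
def biasedParam (ε : ℝ) : unitInterval := Set.projIcc 0 1 zero_le_one (1 / 2 + ε)

lemma coe_biasedParam {ε : ℝ} (hε : 0 ≤ ε) (hε2 : ε ≤ 1 / 2) :
    (biasedParam ε : ℝ) = 1 / 2 + ε := by
  rw [biasedParam, Set.projIcc_of_mem zero_le_one (x := 1 / 2 + ε) ⟨by linarith, by linarith⟩]

/-- The instance in which all arms are fair coins. -/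
def fairInstance (n : ℕ) : Instance n := fun _ => bernoulliReward (biasedParam 0)

/-- The instance in which arm `i` has mean `1 / 2 + ε` and all other arms are fair coins. -/
def biasedInstance (i : Fin n) (ε : ℝ) : Instance n :=
  Function.update (fairInstance n) i (bernoulliReward (biasedParam ε))

/-- The density of a biased coin with respect to a fair one. -/
def coinDensity (ε r : ℝ) : ℝ := if r = 1 then 1 + 2 * ε else 1 - 2 * ε

/-- The density of a round on `biasedInstance i ε` with respect to `fairInstance n`. -/
def roundDensity (i : Fin n) (ε : ℝ) (x : Step n) : ℝ := if x.1 = i then coinDensity ε x.2 else 1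

lemma measurable_coinDensity (ε : ℝ) : Measurable (coinDensity ε) :=
  Measurable.ite (measurableSet_singleton 1) measurable_const measurable_const

lemma measurable_roundDensity (i : Fin n) (ε : ℝ) : Measurable (roundDensity i ε) :=
  Measurable.ite (measurable_fst (measurableSet_singleton i))
    ((measurable_coinDensity ε).comp measurable_snd) measurable_const

lemma roundDensity_pos {ε : ℝ} (hε : 0 < ε) (hε8 : ε ≤ 1 / 8) (i : Fin n) (x : Step n) :
    0 < roundDensity i ε x := by
  unfold roundDensity coinDensity
  split_ifs <;> linarith

lemma roundDensity_le {ε : ℝ} (hε : 0 < ε) (hε8 : ε ≤ 1 / 8) (i : Fin n) (x : Step n) :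
    roundDensity i ε x ≤ 2 := by
  unfold roundDensity coinDensity
  split_ifs <;> linarith

/-- In sum over the arms, the logarithmic density does not depend on the arm that is pulled. -/
lemma sum_log_roundDensity (ε : ℝ) (x : Step n) :
    ∑ i, Real.log (roundDensity i ε x) = Real.log (coinDensity ε x.2) := by
  rw [Finset.sum_eq_single x.1]
  · simp [roundDensity]
  · intro i _ hi
    simp [roundDensity, hi.symm]
  · simp

lemma lintegral_biasedInstance {ε : ℝ} (hε : 0 < ε) (hε8 : ε ≤ 1 / 8) (i a : Fin n)
    (g : ℝ → ℝ≥0∞) :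
    ∫⁻ r, g r ∂(biasedInstance i ε a : Measure ℝ) =
      ∫⁻ r, g r * ENNReal.ofReal (roundDensity i ε (a, r)) ∂(fairInstance n a : Measure ℝ) := by
  by_cases h : a = i
  · subst h
    simp only [biasedInstance, Function.update_self, fairInstance, lintegral_bernoulliReward,
      roundDensity, coinDensity, coe_biasedParam hε.le (by linarith : ε ≤ 1 / 2),
      coe_biasedParam le_rfl (by norm_num : (0 : ℝ) ≤ 1 / 2), if_true]
    rw [mul_left_comm, mul_left_comm _ (g 0), ← ENNReal.ofReal_mul (by norm_num),
      ← ENNReal.ofReal_mul (by norm_num), mul_comm _ (g 1), mul_comm _ (g 0)]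
    congr 3
    · ring
    · norm_num
      ring
  · simp [biasedInstance, roundDensity, h]

lemma mean_biasedInstance {ε : ℝ} (hε : 0 < ε) (hε8 : ε ≤ 1 / 8) (i a : Fin n) :
    (biasedInstance i ε).mean a = if a = i then 1 / 2 + ε else 1 / 2 := by
  by_cases h : a = i
  · subst h
    simp only [Instance.mean, biasedInstance, Function.update_self, integral_bernoulliReward,
      coe_biasedParam hε.le (by linarith : ε ≤ 1 / 2), if_true]
  · simp [Instance.mean, biasedInstance, h, fairInstance, integral_bernoulliReward,
      coe_biasedParam le_rfl (by norm_num : (0 : ℝ) ≤ 1 / 2)]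

/-- As the gap of the fair arms is not strictly below `ε`, only the biased arm is optimal. -/
lemma eq_of_isOptimal_biasedInstance {ε : ℝ} (hε : 0 < ε) (hε8 : ε ≤ 1 / 8) {i a : Fin n}
    (h : (biasedInstance i ε).IsOptimal ε a) : a = i := by
  by_contra ha
  have h1 : (biasedInstance i ε).mean i ≤ ⨆ j, (biasedInstance i ε).mean j :=
    le_ciSup (Set.finite_range _).bddAbove i
  rw [Instance.IsOptimal] at h
  rw [mean_biasedInstance hε hε8, if_pos rfl] at h1
  rw [mean_biasedInstance hε hε8 i a, if_neg ha] at h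
  linarith

lemma biasedInstance_mem (i : Fin n) (ε : ℝ) (a : Fin n) :
    biasedInstance i ε a ∈ bernoulliRewards := by
  by_cases h : a = i
  · subst h
    simpa [biasedInstance] using bernoulliReward_mem _
  · simpa [biasedInstance, h, fairInstance] using bernoulliReward_mem _

/-! ### The information inequality -/

namespace Algorithm

variable (A : Algorithm n)

/-- On fair coins, the expected logarithmic density of a reward that may or may not be collected is
the Kullback-Leibler divergence of the coins times the probability that it is collected. -/
lemma integral_log_coinDensity {ε : ℝ} (hε : 0 < ε) (hε8 : ε ≤ 1 / 8) (s : ℕ) :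
    Integrable (fun ω => if (s : WithTop ℕ) < A.time ω then Real.log (coinDensity ε (ω s).2) else 0)
        (A.law (fairInstance n)) ∧
      ∫ ω, (if (s : WithTop ℕ) < A.time ω then Real.log (coinDensity ε (ω s).2) else 0)
        ∂(A.law (fairInstance n)) =
      (A.law (fairInstance n)).real {ω | (s : WithTop ℕ) < A.time ω} *
        (Real.log (1 - 4 * ε ^ 2) / 2) := by
  set P := A.law (fairInstance n) with hP
  set D := {ω | (s : WithTop ℕ) < A.time ω} with hD
  set E := {ω : ℕ → Step n | (ω s).2 = 1} with hE
  have hDm : MeasurableSet D := measurableSet_of_history (A.measurableSet_lt_time s)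
  have hEm : MeasurableSet E :=
    (measurable_snd.comp (measurable_pi_apply s)) (measurableSet_singleton (1 : ℝ))
  have hprob : P (D ∩ E) = P D * ENNReal.ofReal (1 / 2) := by
    have h1 := A.setLIntegral_reward (ν₀ := fairInstance n)
      (ρ := bernoulliReward (biasedParam 0)) (fun _ => rfl)
      (A.measurableSet_lt_time s) (g := ({1} : Set ℝ).indicator 1)
      (measurable_one.indicator (measurableSet_singleton 1))
    have h2 : ∫⁻ ω in D, ({1} : Set ℝ).indicator 1 (ω s).2 ∂P = P (D ∩ E) := by
      have : ∀ ω : ℕ → Step n, ({1} : Set ℝ).indicator (1 : ℝ → ℝ≥0∞) (ω s).2 =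
          E.indicator 1 ω := fun ω => by
        simp [Set.indicator, hE]
      simp_rw [this]
      rw [lintegral_indicator_one hEm, Measure.restrict_apply hEm, Set.inter_comm]
    rw [← h2, h1, lintegral_bernoulliReward,
      coe_biasedParam le_rfl (by norm_num : (0 : ℝ) ≤ 1 / 2)]
    simp [hP, hD]
  have hfun : (fun ω => if (s : WithTop ℕ) < A.time ω then Real.log (coinDensity ε (ω s).2) else 0)
      = fun ω => D.indicator (fun _ => Real.log (1 - 2 * ε)) ω +
        (D ∩ E).indicator (fun _ => Real.log (1 + 2 * ε) - Real.log (1 - 2 * ε)) ω := by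
    funext ω
    by_cases h1 : (s : WithTop ℕ) < A.time ω <;> by_cases h2 : (ω s).2 = 1 <;>
      simp [Set.indicator, hD, hE, h1, h2, coinDensity]
  have hi1 : Integrable (D.indicator fun _ => Real.log (1 - 2 * ε)) P :=
    (integrable_const _).indicator hDm
  have hi2 : Integrable
      ((D ∩ E).indicator fun _ => Real.log (1 + 2 * ε) - Real.log (1 - 2 * ε)) P :=
    (integrable_const _).indicator (hDm.inter hEm)
  rw [hfun]
  refine ⟨hi1.add hi2, ?_⟩
  rw [integral_add hi1 hi2, integral_indicator_const _ hDm,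
    integral_indicator_const _ (hDm.inter hEm)]
  have hreal : P.real (D ∩ E) = P.real D * (1 / 2) := by
    rw [measureReal_def, hprob, ENNReal.toReal_mul, ENNReal.toReal_ofReal (by norm_num),
      measureReal_def]
  have hlog : Real.log (1 - 4 * ε ^ 2) = Real.log (1 + 2 * ε) + Real.log (1 - 2 * ε) := by
    rw [← Real.log_mul (by linarith) (by linarith)]
    congr 1
    ring
  rw [hreal, hlog]
  simp only [smul_eq_mul]
  ring

/-- The probability of stopping before time `m` with output `i` when arm `i` is the biased one. -/
def correctBefore (ε : ℝ) (i : Fin n) (m : ℕ) : ℝ≥0∞ :=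
  ∑ t ∈ Finset.range m, ∫⁻ ω in {ω | A.time ω = t}, A.output t (hist t ω) {i}
    ∂(A.law (biasedInstance i ε))

/-- The information inequality up to the horizon `m`. The constants `c₁` and `c₂` are the slopes of
the tangents by which the logarithm is bounded on the runs with output `i` and on the other runs;
bounding by tangents takes the place of Jensen's inequality. -/
lemma information_le {ε : ℝ} (hε : 0 < ε) (hε8 : ε ≤ 1 / 8) {c₁ c₂ : ℝ} (hc₂ : 0 < c₂)
    (hc : c₂ ≤ c₁) (hT : A.expectedTime (fairInstance n) ≠ ⊤) (m : ℕ) :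
    ∑ i, ((1 - Real.log c₂ - 1 / c₂) + (1 / c₂ - 1 / c₁) * (A.correctBefore ε i m).toReal) -
        (Real.log c₁ - Real.log c₂) ≤
      (A.expectedTime (fairInstance n)).toReal * (-Real.log (1 - 4 * ε ^ 2) / 2) := by
  have hc₁ : 0 < c₁ := hc₂.trans_le hc
  have hlogc : Real.log c₂ ≤ Real.log c₁ := Real.log_le_log hc₂ hc
  have hinv : 1 / c₁ ≤ 1 / c₂ := one_div_le_one_div_of_le hc₂ hc
  set P := A.law (fairInstance n) with hP
  set L : Fin n → (ℕ → Step n) → ℝ := fun i => A.stoppedLikelihood (roundDensity i ε) m with hL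
  set Φ : Fin n → (ℕ → Step n) → ℝ := fun i ω => (A.outputBefore i m ω).toReal with hΦ
  have hLpos : ∀ i ω, 0 < L i ω := fun i ω =>
    A.stoppedLikelihood_pos (roundDensity_pos hε hε8 i) m ω
  have hLm : ∀ i, Measurable (L i) := fun i =>
    A.measurable_stoppedLikelihood (measurable_roundDensity i ε) m
  have hLi : ∀ i, Integrable (L i) P := fun i =>
    Integrable.of_bound (hLm i).aestronglyMeasurable (2 ^ m) <| .of_forall fun ω => by
      rw [Real.norm_of_nonneg (hLpos i ω).le]
      exact A.stoppedLikelihood_le (roundDensity_pos hε hε8 i) (roundDensity_le hε hε8 i) m ω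
  have hΦ0 : ∀ i ω, 0 ≤ Φ i ω := fun i ω => ENNReal.toReal_nonneg
  have hΦtop : ∀ i ω, A.outputBefore i m ω ≠ ⊤ := fun i ω =>
    ne_top_of_le_ne_top ENNReal.one_ne_top (A.outputBefore_le_one i m ω)
  have hΦ1 : ∀ i ω, Φ i ω ≤ 1 := fun i ω =>
    ENNReal.toReal_le_of_le_ofReal zero_le_one (by simpa using A.outputBefore_le_one i m ω)
  have hΦsum : ∀ ω, ∑ i, Φ i ω ≤ 1 := fun ω => by
    simp only [hΦ]
    rw [← ENNReal.toReal_sum fun i _ => hΦtop i ω]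
    exact ENNReal.toReal_le_of_le_ofReal zero_le_one (by simpa using A.sum_outputBefore_le_one m ω)
  have hΦm : ∀ i, Measurable (Φ i) := fun i => (A.measurable_outputBefore i m).ennreal_toReal
  have hΦLi : ∀ i, Integrable (fun ω => Φ i ω * L i ω) P := fun i =>
    (hLi i).mono ((hΦm i).mul (hLm i)).aestronglyMeasurable <| .of_forall fun ω => by
      rw [norm_mul, Real.norm_of_nonneg (hΦ0 i ω)]
      exact mul_le_of_le_one_left (norm_nonneg _) (hΦ1 i ω)
  have hintL : ∀ i, ∫ ω, L i ω ∂P = 1 := fun i => by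
    rw [integral_eq_lintegral_of_nonneg_ae (.of_forall fun ω => (hLpos i ω).le)
      (hLm i).aestronglyMeasurable,
      A.lintegral_stoppedLikelihood (measurable_roundDensity i ε) (roundDensity_pos hε hε8 i)
        (ν := biasedInstance i ε) (fun a g _ => lintegral_biasedInstance hε hε8 i a g) m]
    rfl
  have hintΦL : ∀ i, ∫ ω, Φ i ω * L i ω ∂P = (A.correctBefore ε i m).toReal := fun i => by
    rw [integral_eq_lintegral_of_nonneg_ae
      (.of_forall fun ω => mul_nonneg (hΦ0 i ω) (hLpos i ω).le)
      ((hΦm i).mul (hLm i)).aestronglyMeasurable]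
    congr 1
    have h1 : ∀ ω, ENNReal.ofReal (Φ i ω * L i ω) =
        A.outputBefore i m ω * ENNReal.ofReal (L i ω) := fun ω => by
      rw [ENNReal.ofReal_mul (hΦ0 i ω), ENNReal.ofReal_toReal (hΦtop i ω)]
    simp_rw [h1]
    rw [A.lintegral_outputBefore_mul P i m (hLm i).ennreal_ofReal, correctBefore]
    refine Finset.sum_congr rfl fun t ht => ?_
    exact A.setLIntegral_mul_stoppedLikelihood (measurable_roundDensity i ε)
      (roundDensity_pos hε hε8 i) (fun a g _ => lintegral_biasedInstance hε hε8 i a g)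
      (A.measurableSet_time_eq t)
      (fun ω hω => A.stoppedLikelihood_of_eq (Finset.mem_range.1 ht).le hω)
      (A.measurable_output i t)
  set R : (ℕ → Step n) → ℝ := fun ω => ∑ i, ((1 - Real.log c₂) - 1 / c₂ * L i ω +
    (1 / c₂ - 1 / c₁) * (Φ i ω * L i ω)) - (Real.log c₁ - Real.log c₂) with hR
  set Q : (ℕ → Step n) → ℝ := fun ω => ∑ s ∈ Finset.range m,
    if (s : WithTop ℕ) < A.time ω then Real.log (coinDensity ε (ω s).2) else 0 with hQ
  have hQL : ∀ ω, Q ω = ∑ i, Real.log (L i ω) := fun ω => by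
    simp only [hL, A.log_stoppedLikelihood (roundDensity_pos hε hε8 _)]
    rw [Finset.sum_comm]
    refine Finset.sum_congr rfl fun s _ => ?_
    split_ifs
    · exact (sum_log_roundDensity ε (ω s)).symm
    · simp
  have htangent : ∀ {c x : ℝ}, 0 < c → 0 < x → Real.log x ≤ Real.log c + 1 / c * x - 1 := by
    intro c x hc hx
    have := Real.log_le_sub_one_of_pos (div_pos hx hc)
    rw [Real.log_div hx.ne' hc.ne'] at this
    rw [one_div_mul_eq_div]
    linarith
  -- the tangent at `c₁` is used with weight `Φ` and the one at `c₂` with weight `1 - Φ`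
  have hpoint : ∀ ω, R ω ≤ -Q ω := fun ω => by
    have h1 : ∀ i, ((1 - Real.log c₂) - 1 / c₂ * L i ω + (1 / c₂ - 1 / c₁) * (Φ i ω * L i ω)) -
        (Real.log c₁ - Real.log c₂) * Φ i ω ≤ -Real.log (L i ω) := fun i => by
      have h2 := mul_le_mul_of_nonneg_left (htangent hc₁ (hLpos i ω)) (hΦ0 i ω)
      have h3 := mul_le_mul_of_nonneg_left (htangent hc₂ (hLpos i ω)) (sub_nonneg.2 (hΦ1 i ω))
      linarith
    have h4 := Finset.sum_le_sum fun i (_ : i ∈ Finset.univ) => h1 i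
    rw [Finset.sum_sub_distrib, ← Finset.mul_sum, Finset.sum_neg_distrib, ← hQL] at h4
    have h5 := mul_le_mul_of_nonneg_left (hΦsum ω) (sub_nonneg.2 hlogc)
    simp only [hR]
    linarith
  have hterm : ∀ i, Integrable (fun ω => (1 - Real.log c₂) - 1 / c₂ * L i ω +
      (1 / c₂ - 1 / c₁) * (Φ i ω * L i ω)) P := fun i =>
    ((integrable_const _).sub ((hLi i).const_mul _)).add ((hΦLi i).const_mul _)
  have hRi : Integrable R P :=
    (integrable_finsetSum _ fun i _ => hterm i).sub (integrable_const _)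
  have hQi : Integrable Q P :=
    integrable_finsetSum _ fun s _ => (A.integral_log_coinDensity hε hε8 s).1
  have hRint : ∫ ω, R ω ∂P = ∑ i, ((1 - Real.log c₂ - 1 / c₂) +
      (1 / c₂ - 1 / c₁) * (A.correctBefore ε i m).toReal) - (Real.log c₁ - Real.log c₂) := by
    simp only [hR]
    rw [integral_sub (integrable_finsetSum _ fun i _ => hterm i) (integrable_const _),
      integral_finsetSum _ fun i _ => hterm i]
    congr 1
    · refine Finset.sum_congr rfl fun i _ => ?_
      have h1 : Integrable (fun ω => (1 - Real.log c₂) - 1 / c₂ * L i ω) P :=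
        (integrable_const _).sub ((hLi i).const_mul _)
      rw [integral_add h1 ((hΦLi i).const_mul _), integral_sub (integrable_const _) ((hLi i).const_mul _), integral_const_mul,
        integral_const_mul, hintL, hintΦL]
      simp
    · simp
  have hκ : 0 ≤ -Real.log (1 - 4 * ε ^ 2) / 2 := by
    have : Real.log (1 - 4 * ε ^ 2) ≤ 0 := Real.log_nonpos (by nlinarith) (by nlinarith)
    linarith
  have hQint : -∫ ω, Q ω ∂P = (∑ s ∈ Finset.range m, P.real {ω | (s : WithTop ℕ) < A.time ω}) *
      (-Real.log (1 - 4 * ε ^ 2) / 2) := by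
    simp only [hQ]
    rw [integral_finsetSum _ fun s _ => (A.integral_log_coinDensity hε hε8 s).1,
      Finset.sum_congr rfl fun s _ => (A.integral_log_coinDensity hε hε8 s).2, ← Finset.sum_mul]
    ring
  rw [← hRint]
  calc ∫ ω, R ω ∂P ≤ ∫ ω, -Q ω ∂P := integral_mono hRi hQi.neg hpoint
    _ = _ := by rw [integral_neg, hQint]
    _ ≤ _ := by
      refine mul_le_mul_of_nonneg_right ?_ hκ
      have h1 := ENNReal.toReal_mono hT (A.sum_measure_lt_time_le (fairInstance n) m)
      rwa [ENNReal.toReal_sum fun s _ => measure_ne_top _ _] at h1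

/-- The information inequality for a PAC algorithm, with the optimal choice of the slopes. -/
lemma information_le_of_isPAC {𝒟 : Set (ProbabilityMeasure ℝ)} (h𝒟 : bernoulliRewards ⊆ 𝒟)
    {ε δ : ℝ} (hn : 2 ≤ n) (hε : 0 < ε) (hε8 : ε ≤ 1 / 8) (hδ : 0 < δ)
    (hδ1 : δ < ((n : ℝ) - 1) / n) (hA : A.IsPAC 𝒟 ε δ)
    (hT : A.expectedTime (fairInstance n) ≠ ⊤) :
    -((n - 1) * Real.log (n * δ / (n - 1))) - Real.log (n * (1 - δ)) ≤
      (A.expectedTime (fairInstance n)).toReal * (-Real.log (1 - 4 * ε ^ 2) / 2) := by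
  have hn' : (2 : ℝ) ≤ n := by exact_mod_cast hn
  have hδn : n * δ < n - 1 := by
    rw [lt_div_iff₀ (by linarith)] at hδ1
    linarith
  set c₁ : ℝ := n * (1 - δ) with hc₁
  set c₂ : ℝ := n * δ / (n - 1) with hc₂
  have hc₂0 : 0 < c₂ := div_pos (by positivity) (by linarith)
  have hc₂1 : c₂ < 1 := by rw [hc₂, div_lt_one (by linarith)]; exact hδn
  have hc₁1 : 1 < c₁ := by rw [hc₁]; linarith
  have hδ2 : δ < 1 := by nlinarith
  have hq : ∀ i : Fin n, 1 - δ ≤ (A.outputProb (biasedInstance i ε) {i}).toReal ∧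
      Filter.Tendsto (fun m => (A.correctBefore ε i m).toReal) Filter.atTop
        (nhds (A.outputProb (biasedInstance i ε) {i}).toReal) := by
    intro i
    have hle : A.outputProb (biasedInstance i ε) {i} ≤ 1 := by
      refine le_of_tendsto' (A.tendsto_sum_outputProb (biasedInstance i ε) i) fun m => ?_
      have h1 := A.lintegral_outputBefore_mul (A.law (biasedInstance i ε)) i m
        (f := fun _ => 1) measurable_const
      simp only [mul_one] at h1
      rw [← h1]
      calc _ ≤ ∫⁻ _, 1 ∂(A.law (biasedInstance i ε)) :=
            lintegral_mono fun ω => A.outputBefore_le_one i m ω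
        _ = 1 := by simp
    have htop := ne_top_of_le_ne_top ENNReal.one_ne_top hle
    refine ⟨?_, (ENNReal.tendsto_toReal htop).comp (A.tendsto_sum_outputProb _ i)⟩
    rw [← ENNReal.ofReal_le_iff_le_toReal htop]
    exact (hA _ fun a => h𝒟 (biasedInstance_mem i ε a)).trans
      (A.outputProb_mono _ fun a ha => eq_of_isOptimal_biasedInstance hε hε8 ha)
  have hlim := le_of_tendsto' ((tendsto_finsetSum Finset.univ fun i _ =>
    (tendsto_const_nhds (x := 1 - Real.log c₂ - 1 / c₂)).add
      ((hq i).2.const_mul (1 / c₂ - 1 / c₁))).sub_const (Real.log c₁ - Real.log c₂))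
    fun m => A.information_le hε hε8 hc₂0 (hc₂1.trans hc₁1).le hT m
  refine le_trans ?_ hlim
  have hinv : 1 / c₁ ≤ 1 / c₂ := one_div_le_one_div_of_le hc₂0 (hc₂1.trans hc₁1).le
  -- with this choice of the slopes, the terms other than logarithms cancel
  have hbal : 1 - 1 / c₂ + (1 / c₂ - 1 / c₁) * (1 - δ) = 0 := by
    have h1 : (n : ℝ) - 1 ≠ 0 := by linarith
    have h2 : (n : ℝ) ≠ 0 := by linarith
    have h3 : 1 - δ ≠ 0 := by linarith
    rw [hc₁, hc₂]
    field_simp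
    ring
  have hsum := Finset.sum_le_sum fun i (_ : i ∈ (Finset.univ : Finset (Fin n))) =>
    add_le_add_right (mul_le_mul_of_nonneg_left (hq i).1 (sub_nonneg.2 hinv))
      (1 - Real.log c₂ - 1 / c₂)
  rw [Finset.sum_const, Finset.card_univ, Fintype.card_fin, nsmul_eq_mul] at hsum
  have h1 : 1 - Real.log c₂ - 1 / c₂ + (1 / c₂ - 1 / c₁) * (1 - δ) = -Real.log c₂ := by linarith
  rw [h1] at hsum
  linarith

end Algorithm

/-! ### The lower bound -/

lemma add_sq_div_two_le_neg_log {y : ℝ} (hy0 : 0 ≤ y) (hy1 : y < 1) :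
    y + y ^ 2 / 2 ≤ -Real.log (1 - y) := by
  have h := Real.hasSum_pow_div_log_of_abs_lt_one (x := y) (by rwa [abs_of_nonneg hy0])
  have h1 := sum_le_hasSum (Finset.range 2) (fun i _ => by positivity) h
  norm_num [Finset.sum_range_succ] at h1
  linarith

/-- Lower bound, with a constant that vanishes with `β`. -/
lemma le_sampleComplexity {𝒟 : Set (ProbabilityMeasure ℝ)} (h𝒟 : bernoulliRewards ⊆ 𝒟)
    {β ε δ : ℝ} (hβ : 0 < β) (hn : 2 ≤ n) (hε : 0 < ε) (hε8 : ε ≤ 1 / 8) (hδ : 0 < δ)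
    (hδβ : δ ≤ ((n : ℝ) - 1) / n * (1 - β)) :
    ENNReal.ofReal (β / (3 * (2 + β)) * (((n : ℝ) - 1) / ε ^ 2 *
      Real.log (((n : ℝ) - 1) / (n * δ)))) ≤ sampleComplexity 𝒟 n ε δ := by
  refine le_iInf₂ fun A hA => le_trans ?_ (le_iSup₂ (f := fun (ν : Instance n)
    (_ : ∀ i, ν i ∈ 𝒟) => A.expectedTime ν) (fairInstance n)
    fun i => h𝒟 (bernoulliReward_mem _))
  by_cases hT : A.expectedTime (fairInstance n) = ⊤
  · rw [hT]; exact le_top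
  rw [ENNReal.ofReal_le_iff_le_toReal hT]
  have hn' : (2 : ℝ) ≤ n := by exact_mod_cast hn
  have hpos : 0 < ((n : ℝ) - 1) / n := div_pos (by linarith) (by linarith)
  have h1 := A.information_le_of_isPAC h𝒟 hn hε hε8 hδ (by nlinarith) hA hT
  set x : ℝ := n * δ / (n - 1) with hx
  have hx0 : 0 < x := div_pos (by positivity) (by linarith)
  have hxβ : x ≤ 1 - β := by
    rw [hx, div_le_iff₀ (by linarith)]
    have := mul_le_mul_of_nonneg_left hδβ (by linarith : (0 : ℝ) ≤ n)
    calc n * δ ≤ n * (((n : ℝ) - 1) / n * (1 - β)) := this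
      _ = _ := by field_simp
  have hlog : Real.log (((n : ℝ) - 1) / (n * δ)) = -Real.log x := by
    rw [hx, ← Real.log_inv, inv_div]
  set T := (A.expectedTime (fairInstance n)).toReal
  have hT0 : 0 ≤ T := ENNReal.toReal_nonneg
  have h2 : Real.log (n * (1 - δ)) ≤ (n - 1) * (1 - x) := by
    have h3 : (n : ℝ) * (1 - δ) = 1 + (n - 1) * (1 - x) := by
      have : ((n : ℝ) - 1) * x = n * δ := mul_div_cancel₀ _ (by linarith)
      linarith
    have h4 : 0 ≤ ((n : ℝ) - 1) * (1 - x) := mul_nonneg (by linarith) (by linarith)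
    have := Real.log_le_sub_one_of_pos (x := n * (1 - δ)) (by rw [h3]; linarith)
    linarith
  have h3 : (1 - x) * (2 + β) ≤ 2 * -Real.log x := by
    have := add_sq_div_two_le_neg_log (y := 1 - x) (by linarith) (by linarith)
    rw [sub_sub_cancel] at this
    nlinarith
  have h4 : -Real.log (1 - 4 * ε ^ 2) / 2 ≤ 3 * ε ^ 2 := by
    have h5 : (15 : ℝ) / 16 ≤ 1 - 4 * ε ^ 2 := by nlinarith
    have h6 := Real.one_sub_inv_le_log_of_pos (x := 1 - 4 * ε ^ 2) (by linarith)
    have h7 : (1 - 4 * ε ^ 2)⁻¹ ≤ 1 + 6 * ε ^ 2 := by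
      rw [inv_le_iff_one_le_mul₀ (by linarith)]
      nlinarith [sq_nonneg ε]
    linarith
  have h5 : -((n - 1) * Real.log x) - (n - 1) * (1 - x) ≤ T * (3 * ε ^ 2) := by
    have := mul_le_mul_of_nonneg_left h4 hT0
    linarith
  have h6 : β * ((n - 1) * -Real.log x) ≤ T * (3 * ε ^ 2) * (2 + β) := by
    have h7 := mul_le_mul_of_nonneg_right h5 (by linarith : (0 : ℝ) ≤ 2 + β)
    have h8 := mul_le_mul_of_nonneg_left h3 (by linarith : (0 : ℝ) ≤ (n : ℝ) - 1)
    linarith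
  rw [hlog]
  have h7 : β / (3 * (2 + β)) * (((n : ℝ) - 1) / ε ^ 2 * -Real.log x) =
      β * ((n - 1) * -Real.log x) / (3 * ε ^ 2 * (2 + β)) := by
    field_simp
  rw [h7, div_le_iff₀ (by positivity)]
  linarith

end Bandit

end

theorem mainTheorem5 (β : ℝ) (hβ0 : 0 < β) (hβ1 : β < 1) :
    ∃ c C : ℝ, 0 < c ∧ 0 < C ∧
      ∀ (𝒟 : Set (ProbabilityMeasure ℝ)),
        Bandit.bernoulliRewards ⊆ 𝒟 → 𝒟 ⊆ Bandit.unitRewards →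
      ∀ (n : ℕ) (ε δ : ℝ), 2 ≤ n → 0 < ε → ε ≤ 1 / 8 →
        0 < δ → δ ≤ ((n : ℝ) - 1) / n * (1 - β) →
        ENNReal.ofReal
            (c * (((n : ℝ) - 1) / ε ^ 2 * Real.log (((n : ℝ) - 1) / (n * δ)))) ≤
          Bandit.sampleComplexity 𝒟 n ε δ ∧
        Bandit.sampleComplexity 𝒟 n ε δ ≤
          ENNReal.ofReal
            (C * (((n : ℝ) - 1) / ε ^ 2 * Real.log (((n : ℝ) - 1) / (n * δ)))) := by
  refine ⟨β / (3 * (2 + β)), 16064 * (1 + 2 / β), by positivity, by positivity, ?_⟩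
  intro 𝒟 hb hu n ε δ hn hε hε8 hδ hδβ
  refine ⟨Bandit.le_sampleComplexity hb hβ0 hn hε hε8 hδ hδβ, ?_⟩
  have hn' : (2 : ℝ) ≤ n := by exact_mod_cast hn
  have hn1 : (0 : ℝ) < (n : ℝ) - 1 := by linarith
  have hδn : n * δ ≤ (n - 1) * (1 - β) := by
    calc n * δ ≤ n * (((n : ℝ) - 1) / n * (1 - β)) :=
          mul_le_mul_of_nonneg_left hδβ (by linarith)
      _ = _ := by field_simp
  have hδ1 : δ < 1 := by nlinarith
  refine (Bandit.sampleComplexity_le hu hn hε (by linarith) hδ hδ1).trans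
    (ENNReal.ofReal_le_ofReal ?_)
  set L := Real.log (((n : ℝ) - 1) / (n * δ)) with hL
  have hβL : β ≤ L := by
    have h1 := Real.one_sub_inv_le_log_of_pos (x := ((n : ℝ) - 1) / (n * δ)) (by positivity)
    have h2 : (((n : ℝ) - 1) / (n * δ))⁻¹ ≤ 1 - β := by
      rw [inv_div, div_le_iff₀ hn1]
      linarith
    linarith
  -- the logarithms differ by at most `log 4`, and `L` is bounded away from zero
  have hlog : Real.log (2 / δ) ≤ L * (1 + 2 / β) := by
    have h1 : Real.log (2 / δ) ≤ L + Real.log 4 := by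
      rw [hL, ← Real.log_mul (by positivity) (by norm_num)]
      refine Real.log_le_log (by positivity) ?_
      rw [div_mul_eq_mul_div, div_le_div_iff₀ hδ (by positivity)]
      nlinarith [mul_pos hδ hn1]
    have h2 : Real.log 4 ≤ 2 := by
      have h3 : (4 : ℝ) = 2 ^ 2 := by norm_num
      rw [h3, Real.log_pow]
      norm_num
      linarith [Real.log_two_lt_d9]
    have h4 : 2 ≤ L * (2 / β) := by
      rw [mul_div_assoc', le_div_iff₀ hβ0]
      linarith
    linarith
  have hL0 : 0 < L := hβ0.trans_le hβL
  calc 8032 * n * Real.log (2 / δ) / ε ^ 2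
      ≤ 8032 * (2 * (n - 1)) * (L * (1 + 2 / β)) / ε ^ 2 := by
        have : (n : ℝ) ≤ 2 * (n - 1) := by linarith
        have h0 : 0 ≤ Real.log (2 / δ) := Real.log_nonneg (by rw [le_div_iff₀ hδ]; linarith)
        gcongr
    _ = _ := by ring
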